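/- \textbf{Setting.} lqCCS processes are tagged processes $P ::= \mathbf 0_{\tilde e} \mid t{:}\tau.P \mid (t,t'){:}\tau.P \mid t{:}c?x.P \mid t{:}c!e.P \mid t{:}\mathcal E(\tilde e).P \mid t{:}\mathcal M(\tilde e\rhd x).P \mid \mathbf{if}\ e\ \mathbf{then}\ P\ \mathbf{else}\ P \mid P+P \mid P\parallel P \mid P\setminus c$, with typed variables and channels (numbers, booleans, qubit names), $\mathcal E$ a trace-preserving superoperator on $n>0$ qubits and $\mathcal M$ a measurement. The linear type system $\Sigma\vdash P$ assigns to $P$ the set $\Sigma=\Sigma_P$ of qubits it owns; parallel components own disjoint sets. A configuration $\langle\rho,P\rangle$ consists of a density operator $\rho$ of trace one on the qubits of a finite set $\Sigma_\rho$ of qubit names, and of a closed process $P$ with $\Sigma_P\subseteq\Sigma_\rho$; its type is $(\Sigma_\rho,\Sigma_P)$. Its transitions $\langle\rho,P\rangle\xrightarrow{\mu}_s\Delta$ carry an action $\mu$ (which is $\tau$, $c!v$ or $c?v$) and a scheduler $s$ (a tag, or a pair of tags), and lead to a finitely supported probability distribution of configurations. The prefixes tagged $t$ move with scheduler $t$,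 and $(t,t'){:}\tau$ with scheduler $(t,t')$: $\tau$ only continues; $\mathcal E(\tilde q).P$ moves by $\tau$ to $1\bullet\langle\mathcal E^{\tilde q}(\rho),P\rangle$; $\mathcal M(\tilde q\rhd x).P$ with $\mathcal M=\{M_m\}$ moves by $\tau$ to $\bigoplus_m p_m\bullet\langle \mathcal M_m^{\tilde q}(\rho)/p_m,P[m/x]\rangle$, where $\mathcal M_m(\rho)=M_m\rho M_m^\dagger$ and $p_m=\mathrm{tr}\,\mathcal M_m^{\tilde q}(\rho)$ (the superscript $\tilde q$ means: acting on the qubits $\tilde q$ and as the identity on the others, and outcomes with $p_m=0$ are omitted); $c!e.P$ moves by $c!v$ to $P$, with $v$ the value of $e$; $c?x.P$ moves by $c?v$ to $P[v/x]$ for every $v$ of the type of $c$, where a received qubit must belong to $\Sigma_\rho$ and not be owned by the receiving process. Conditionals and sums move as the selected branch. In $P\parallel Q$ either side may move alone (but not receive a qubit owned by the other), and an output $c!v$ and an input $c?v$ of the two sides with schedulers $t$ (left) and $t'$ (right) synchronize to a $\tau$ with scheduler $(t,t')$. $P\setminus c$ forbids the actions $c!v$ and $c?v$. A process is \emph{locally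 deterministic} if, in any state on a superset of its qubits, two transitions with the same scheduler either coincide in action and target, or have different actions that are inputs on the same channel. A process is \emph{deterministic} if it and all the processes reachable from it by transitions (in arbitrary states) are locally deterministic. All processes, including those of the contexts below, are deterministic. Distributions are finitely supported and have mass at most $1$; $\Delta$ has type $(\Sigma,\Sigma')$, where $\Sigma'\subseteq\Sigma$, if all configurations of its support have. The relation $\Rightarrow_s$ between distributions is the smallest left-linear relation such that $1\bullet\mathcal C\Rightarrow_s\Delta$ if $\mathcal C\xrightarrow{\tau}_s\Delta$, and $1\bullet\mathcal C\Rightarrow_s\varepsilon$ (the empty distribution) if $\mathcal C$ has no $\tau$-transition with scheduler $s$. Here a relation $\mathcal R$ is left-linear if $\Delta_i\mathrel{\mathcal R}\Theta_i$ for all $i$ in a finite set, $p_i\in[0,1]$ and $\bigoplus_i p_i\Delta_i$ of mass at most $1$ imply that $\bigoplus_i p_i\Theta_i$ has mass at most $1$ and $\bigoplus_i p_i\Delta_i\mathrel{\mathcal R}\bigoplus_i p_i\Theta_i$. A context $B[\cdot]$ is $[\cdot]$ or $[\cdot]\parallel R$ with $R$ closed and deterministic. It is compatible with $\Delta$, of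 type $(\Sigma,\Sigma')$, if $R$ is typed by qubits of $\Sigma\setminus\Sigma'$ and no tag occurs both in $R$ and in $\Delta$; $B[\Delta]$ replaces each $\langle\rho,P\rangle$ by $\langle\rho,B[P]\rangle$. A \emph{scheduled saturated bisimulation} is a relation $\mathcal R$ between distributions such that $\Delta\mathrel{\mathcal R}\Theta$ implies: $\Delta$ and $\Theta$ have a common type and the same mass, and for every context $B[\cdot]$ compatible with both and every scheduler $s$, each move $B[\Delta]\Rightarrow_s\Delta'$ is matched by some $B[\Theta]\Rightarrow_s\Theta'$ with $\Delta'\mathrel{\mathcal R}\Theta'$, and vice versa. \emph{Scheduled saturated bisimilarity} $\sim$ is the largest such relation. \textbf{Theorem.} Let $\Sigma$ be a finite set of qubit names and let $P$ be a closed, deterministic process with $\Sigma_P\vdash P$ and $\Sigma_P\subseteq\Sigma$. Let $(p_i)_{i\in I}$ and $(q_j)_{j\in J}$ be finite families of non-negative reals with $\sum_i p_i\le 1$ and $\sum_j q_j\le 1$, and let $\rho_i$ $(i\in I)$ and $\sigma_j$ $(j\in J)$ be density operators of trace one on the qubits of $\Sigma$. If \[\sum_{i} p_i\,\rho_i=\sum_{j}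 q_j\,\sigma_j,\] then \[\bigoplus_{i} p_i\bullet\langle\rho_i,P\rangle\;\sim\;\bigoplus_{j} q_j\bullet\langle\sigma_j,P\rangle .\] -/

import Mathlib

open scoped NNReal Matrix ComplexOrder

namespace LqCCS

/-! ## Names, values and expressions -/

/-- The three types of data: natural numbers, booleans, qubit names. -/
inductive Ty where
  | nat | bool | qubit
  deriving DecidableEq

/-- Qubit names. -/
abbrev QName := ℕ

/-- Tags, a denumerable set. -/
abbrev Tag := ℕ

/-- Variables come with the type of their possible values. -/
structure Var where
  ty : Ty
  name : ℕ
  deriving DecidableEq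

/-- Channels come with the type of the values they propagate. -/
structure Chan where
  ty : Ty
  name : ℕ
  deriving DecidableEq

inductive Value where
  | nat (n : ℕ)
  | bool (b : Bool)
  | qubit (q : QName)
  deriving DecidableEq

def Value.ty : Value → Ty
  | .nat _ => .nat
  | .bool _ => .bool
  | .qubit _ => .qubit

inductive Expr where
  | var (x : Var)
  | bool (b : Bool)
  | nat (n : ℕ)
  | qubit (q : QName)
  | not (e : Expr)
  | or (e e' : Expr)
  | le (e e' : Expr)
  | eq (e e' : Expr)

def Value.toExpr : Value → Expr
  | .nat n => .nat n
  | .bool b => .bool b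
  | .qubit q => .qubit q

/-- The variables of an expression. -/
def Expr.fv : Expr → Set Var
  | .var x => {x}
  | .bool _ => ∅
  | .nat _ => ∅
  | .qubit _ => ∅
  | .not e => e.fv
  | .or e e' => e.fv ∪ e'.fv
  | .le e e' => e.fv ∪ e'.fv
  | .eq e e' => e.fv ∪ e'.fv

/-- `e.subst x v` is `e[v/x]`. -/
def Expr.subst (x : Var) (v : Value) : Expr → Expr
  | .var y => if y = x then v.toExpr else .var y
  | .bool b => .bool b
  | .nat n => .nat n
  | .qubit q => .qubit q
  | .not e => .not (e.subst x v)
  | .or e e' => .or (e.subst x v) (e'.subst x v)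
  | .le e e' => .le (e.subst x v) (e'.subst x v)
  | .eq e e' => .eq (e.subst x v) (e'.subst x v)

/-- Typing of expressions; `x = y` compares two values of the same type
(for qubits it compares the two names). -/
inductive Expr.HasType : Expr → Ty → Prop where
  | var (x : Var) : HasType (.var x) x.ty
  | bool (b : Bool) : HasType (.bool b) .bool
  | nat (n : ℕ) : HasType (.nat n) .nat
  | qubit (q : QName) : HasType (.qubit q) .qubit
  | not {e : Expr} : HasType e .bool → HasType (.not e) .bool
  | or {e e' : Expr} : HasType e .bool → HasType e' .bool → HasType (.or e e') .bool
  | le {e e' : Expr} : HasType e .nat → HasType e' .nat → HasType (.le e e') .bool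
  | eq {e e' : Expr} {T : Ty} : HasType e T → HasType e' T → HasType (.eq e e') .bool

/-- Big-step evaluation, `e ⇓ v`. Variables are not evaluated. -/
inductive Expr.Eval : Expr → Value → Prop where
  | bool (b : Bool) : Eval (.bool b) (.bool b)
  | nat (n : ℕ) : Eval (.nat n) (.nat n)
  | qubit (q : QName) : Eval (.qubit q) (.qubit q)
  | not {e : Expr} {b : Bool} : Eval e (.bool b) → Eval (.not e) (.bool (!b))
  | or {e e' : Expr} {b b' : Bool} : Eval e (.bool b) → Eval e' (.bool b') →
      Eval (.or e e') (.bool (b || b'))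
  | le {e e' : Expr} {n n' : ℕ} : Eval e (.nat n) → Eval e' (.nat n') →
      Eval (.le e e') (.bool (decide (n ≤ n')))
  | eq {e e' : Expr} {v v' : Value} : Eval e v → Eval e' v' →
      Eval (.eq e e') (.bool (decide (v = v')))

/-- The expressions that may denote a qubit: qubit names and variables of qubit type. -/
def Expr.IsQubit : Expr → Prop
  | .qubit _ => True
  | .var x => x.ty = .qubit
  | _ => False

/-! ## Quantum operations -/

/-- Operators on `n` qubits, in the computational basis `|b₀ … bₙ₋₁⟩`. -/
abbrev Op (n : ℕ) := Matrix (Fin n → Fin 2) (Fin n → Fin 2) ℂ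

/-- A trace-preserving superoperator on `n > 0` qubits, given by a Kraus decomposition. -/
structure Superop (n : ℕ) where
  pos : 0 < n
  card : ℕ
  kraus : Fin card → Op n
  complete : ∑ i, (kraus i)ᴴ * kraus i = 1

/-- A measurement on `n` qubits with outcomes `0, …, card - 1`. -/
structure Measurement (n : ℕ) where
  card : ℕ
  op : Fin card → Op n
  complete : ∑ m, (op m)ᴴ * op m = 1

/-- Operators on the Hilbert space of the qubits named in `S`. The computational basis is indexed
by the assignments of a bit to every name, so that no order of the qubits has to be fixed. -/
abbrev OpOn (S : Finset QName) := Matrix (S → Fin 2) (S → Fin 2) ℂ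

/-- A density operator of trace one on the qubits named in `S`. -/
structure Density (S : Finset QName) where
  mat : OpOn S
  posSemidef : mat.PosSemidef
  trace_eq_one : mat.trace = 1

open Classical in
/-- `K` applied to the qubits `q 0, …, q (n - 1)`, tensored with the identity on the other qubits
of `S` (the conjugation of `K ⊗ 𝟙` by the permutation that brings the qubits `q` in front). -/
noncomputable def embed {S : Finset QName} {n : ℕ} (q : Fin n ↪ S) (K : Op n) : OpOn S :=
  Matrix.of fun a b =>
    if ∀ i, i ∉ Set.range q → a i = b i then K (a ∘ q) (b ∘ q) else 0

/-- The map `ρ ↦ K ρ K†`, with `K` acting on the qubits `q`. -/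
noncomputable def conjOn {S : Finset QName} {n : ℕ} (q : Fin n ↪ S) (K : Op n) (ρ : OpOn S) :
    OpOn S :=
  embed q K * ρ * (embed q K)ᴴ

/-- The superoperator `E` applied to the qubits `q` of `ρ`. -/
noncomputable def Superop.applyOn {S : Finset QName} {n : ℕ} (E : Superop n) (q : Fin n ↪ S)
    (ρ : OpOn S) : OpOn S :=
  ∑ i, conjOn q (E.kraus i) ρ

/-! ## Processes -/

/-- Tagged lqCCS processes. -/
inductive Proc where
  /-- `0_{e₀,…,eₙ₋₁}` -/
  | nil {n : ℕ} (es : Fin n → Expr)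
  /-- `t : τ . P` -/
  | tau (t : Tag) (P : Proc)
  /-- `(t, t') : τ . P` -/
  | tauPair (t t' : Tag) (P : Proc)
  /-- `t : c?x . P` -/
  | recv (t : Tag) (c : Chan) (x : Var) (P : Proc)
  /-- `t : c!e . P` -/
  | send (t : Tag) (c : Chan) (e : Expr) (P : Proc)
  /-- `t : E(e₀,…,eₙ₋₁) . P` -/
  | op (t : Tag) {n : ℕ} (E : Superop n) (es : Fin n → Expr) (P : Proc)
  /-- `t : M(e₀,…,eₙ₋₁ ▷ x) . P` -/
  | meas (t : Tag) {n : ℕ} (M : Measurement n) (es : Fin n → Expr) (x : Var) (P : Proc)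
  | ite (e : Expr) (P Q : Proc)
  | sum (P Q : Proc)
  | par (P Q : Proc)
  /-- `P \ c` -/
  | restr (P : Proc) (c : Chan)

namespace Proc

/-- The free variables of a process. -/
def fv : Proc → Set Var
  | nil es => ⋃ i, (es i).fv
  | tau _ P => P.fv
  | tauPair _ _ P => P.fv
  | recv _ _ x P => P.fv \ {x}
  | send _ _ e P => e.fv ∪ P.fv
  | op _ _ es P => (⋃ i, (es i).fv) ∪ P.fv
  | meas _ _ es x P => (⋃ i, (es i).fv) ∪ (P.fv \ {x})
  | ite e P Q => e.fv ∪ P.fv ∪ Q.fv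
  | sum P Q => P.fv ∪ Q.fv
  | par P Q => P.fv ∪ Q.fv
  | restr P _ => P.fv

def Closed (P : Proc) : Prop := P.fv = ∅

/-- `P.subst x v` is `P[v/x]`; no capture can occur, since values have no variables. -/
def subst (x : Var) (v : Value) : Proc → Proc
  | nil es => nil fun i => (es i).subst x v
  | tau t P => tau t (P.subst x v)
  | tauPair t t' P => tauPair t t' (P.subst x v)
  | recv t c y P => recv t c y (if y = x then P else P.subst x v)
  | send t c e P => send t c (e.subst x v) (P.subst x v)
  | op t E es P => op t E (fun i => (es i).subst x v) (P.subst x v)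
  | meas t M es y P =>
      meas t M (fun i => (es i).subst x v) y (if y = x then P else P.subst x v)
  | ite e P Q => ite (e.subst x v) (P.subst x v) (Q.subst x v)
  | sum P Q => sum (P.subst x v) (Q.subst x v)
  | par P Q => par (P.subst x v) (Q.subst x v)
  | restr P c => restr (P.subst x v) c

/-- The tags that appear in a process. -/
def tags : Proc → Set Tag
  | nil _ => ∅
  | tau t P => {t} ∪ P.tags
  | tauPair t t' P => {t, t'} ∪ P.tags
  | recv t _ _ P => {t} ∪ P.tags
  | send t _ _ P => {t} ∪ P.tags
  | op t _ _ P => {t} ∪ P.tags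
  | meas t _ _ _ P => {t} ∪ P.tags
  | ite _ P Q => P.tags ∪ Q.tags
  | sum P Q => P.tags ∪ Q.tags
  | par P Q => P.tags ∪ Q.tags
  | restr P _ => P.tags

end Proc

/-- The typing judgment `Γ ⊢ P`, where `Γ` is a set of qubit names and of variables of qubit type:
the qubits owned by `P`. -/
inductive Typing : Set Expr → Proc → Prop where
  | nil {n : ℕ} {es : Fin n → Expr} (hes : ∀ i, (es i).IsQubit) (hinj : Function.Injective es) :
      Typing (Set.range es) (.nil es)
  | tau {Γ : Set Expr} {t : Tag} {P : Proc} : Typing Γ P → Typing Γ (.tau t P)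
  | tauPair {Γ : Set Expr} {t t' : Tag} {P : Proc} : Typing Γ P → Typing Γ (.tauPair t t' P)
  | op {Γ : Set Expr} {t : Tag} {n : ℕ} {E : Superop n} {es : Fin n → Expr} {P : Proc}
      (hinj : Function.Injective es) (hes : Set.range es ⊆ Γ) :
      Typing Γ P → Typing Γ (.op t E es P)
  | meas {Γ : Set Expr} {t : Tag} {n : ℕ} {M : Measurement n} {es : Fin n → Expr} {x : Var}
      {P : Proc} (hinj : Function.Injective es) (hes : Set.range es ⊆ Γ) (hx : x.ty = .nat) :
      Typing Γ P → Typing Γ (.meas t M es x P)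
  | crecv {Γ : Set Expr} {t : Tag} {c : Chan} {x : Var} {P : Proc}
      (hc : c.ty ≠ .qubit) (hx : x.ty = c.ty) :
      Typing Γ P → Typing Γ (.recv t c x P)
  | qrecv {Γ : Set Expr} {t : Tag} {c : Chan} {x : Var} {P : Proc}
      (hc : c.ty = .qubit) (hx : x.ty = .qubit) (hfresh : Expr.var x ∉ Γ) :
      Typing (Γ ∪ {Expr.var x}) P → Typing Γ (.recv t c x P)
  | csend {Γ : Set Expr} {t : Tag} {c : Chan} {e : Expr} {P : Proc}
      (hc : c.ty ≠ .qubit) (he : e.HasType c.ty) :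
      Typing Γ P → Typing Γ (.send t c e P)
  | qsend {Γ : Set Expr} {t : Tag} {c : Chan} {e : Expr} {P : Proc}
      (hc : c.ty = .qubit) (hq : e.IsQubit) (he : e ∈ Γ) :
      Typing (Γ \ {e}) P → Typing Γ (.send t c e P)
  | ite {Γ : Set Expr} {e : Expr} {P Q : Proc} (he : e.HasType .bool) :
      Typing Γ P → Typing Γ Q → Typing Γ (.ite e P Q)
  | sum {Γ : Set Expr} {P Q : Proc} : Typing Γ P → Typing Γ Q → Typing Γ (.sum P Q)
  | par {Γ Γ' : Set Expr} {P Q : Proc} (hdisj : Disjoint Γ Γ') :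
      Typing Γ P → Typing Γ' Q → Typing (Γ ∪ Γ') (.par P Q)
  | restr {Γ : Set Expr} {P : Proc} {c : Chan} : Typing Γ P → Typing Γ (.restr P c)

/-- The qubit names in the (unique) typing context of `P`. -/
def Proc.owned (P : Proc) : Set QName := {q | ∃ Γ, Typing Γ P ∧ Expr.qubit q ∈ Γ}

/-! ## Probability distributions -/

/-- Finitely supported probability distributions of mass at most one. -/
structure SDist (A : Type) where
  weight : A →₀ ℝ≥0
  mass_le_one : (weight.sum fun _ p => p) ≤ 1

namespace SDist

variable {A B : Type}

def mass (Δ : SDist A) : ℝ≥0 := Δ.weight.sum fun _ p => p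

/-- The empty distribution. -/
noncomputable def empty : SDist A where
  weight := 0
  mass_le_one := by simp

/-- The distribution `1 • a`. -/
noncomputable def point (a : A) : SDist A where
  weight := Finsupp.single a 1
  mass_le_one := by simp

/-- The distribution `⨁ i, p i • a i`, defined when `∑ i, p i ≤ 1`. -/
noncomputable def mix {ι : Type*} [Fintype ι] (p : ι → ℝ≥0) (a : ι → A) (hp : ∑ i, p i ≤ 1) :
    SDist A where
  weight := ∑ i, Finsupp.single (a i) (p i)
  mass_le_one := by
    have h : ((∑ i, Finsupp.single (a i) (p i)).sum fun _ r => r) = ∑ i, p i := by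
      rw [← Finsupp.sum_finsetSum_index (fun _ => rfl) (fun _ _ _ => rfl)]
      simp
    rw [h]
    exact hp

/-- The distribution obtained by applying `f` to every element of the support. -/
noncomputable def map (f : A → B) (Δ : SDist A) : SDist B where
  weight := Δ.weight.mapDomain f
  mass_le_one := by
    rw [Finsupp.sum_mapDomain_index (fun _ => rfl) (fun _ _ _ => rfl)]
    exact Δ.mass_le_one

end SDist

/-- The left-linear lifting of `R`: the smallest left-linear relation that relates `1 • a` to `Θ`
whenever `R a Θ`. In the second rule `Δ = ⨁ i, p i • Δs i` and `Θ = ⨁ i, p i • Θs i`. -/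
inductive Lift {A B : Type} (R : A → SDist B → Prop) : SDist A → SDist B → Prop where
  | base {a : A} {Θ : SDist B} : R a Θ → Lift R (SDist.point a) Θ
  | linear {n : ℕ} (p : Fin n → ℝ≥0) (hp : ∀ i, p i ≤ 1)
      (Δs : Fin n → SDist A) (Θs : Fin n → SDist B) (h : ∀ i, Lift R (Δs i) (Θs i))
      (Δ : SDist A) (hΔ : Δ.weight = ∑ i, p i • (Δs i).weight)
      (Θ : SDist B) (hΘ : Θ.weight = ∑ i, p i • (Θs i).weight) :
      Lift R Δ Θ

/-! ## Operational semantics -/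

/-- Configurations `⟨ρ, P⟩`, with `ρ` a state of the qubits named in `qubits`. -/
structure Conf where
  qubits : Finset QName
  state : Density qubits
  proc : Proc

/-- `(S, Γ) ⊢ C`, for closed processes. -/
def Conf.Typed (S : Finset QName) (Γ : Set Expr) (C : Conf) : Prop :=
  C.qubits = S ∧ Γ ⊆ Expr.qubit '' (S : Set QName) ∧ C.proc.Closed ∧ Typing Γ C.proc

/-- `(S, Γ) ⊢ Δ`. -/
def DistTyped (S : Finset QName) (Γ : Set Expr) (Δ : SDist Conf) : Prop :=
  Γ ⊆ Expr.qubit '' (S : Set QName) ∧ ∀ C ∈ Δ.weight.support, C.Typed S Γ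

/-- The tags that appear in the processes of a distribution. -/
def distTags (Δ : SDist Conf) : Set Tag := ⋃ C ∈ Δ.weight.support, C.proc.tags

inductive Act where
  | tau
  | send (c : Chan) (v : Value)
  | recv (c : Chan) (v : Value)

/-- Schedulers: a tag or a pair of tags. -/
inductive Sched where
  | one (t : Tag)
  | pair (t t' : Tag)

def Sched.tags : Sched → Set Tag
  | .one t => {t}
  | .pair t t' => {t, t'}

/-- The transition relation of configurations, `Step C μ s Δ`. -/
inductive Step : Conf → Act → Sched → SDist Conf → Prop where
  | tau {S : Finset QName} {ρ : Density S} {t : Tag} {P : Proc} :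
      Step ⟨S, ρ, .tau t P⟩ .tau (.one t) (SDist.point ⟨S, ρ, P⟩)
  | tauPair {S : Finset QName} {ρ : Density S} {t t' : Tag} {P : Proc} :
      Step ⟨S, ρ, .tauPair t t' P⟩ .tau (.pair t t') (SDist.point ⟨S, ρ, P⟩)
  /-- `ρ'` is the density operator obtained by applying `E` to the qubits `q` of `ρ`. -/
  | op {S : Finset QName} {ρ : Density S} {t : Tag} {n : ℕ} {E : Superop n} {q : Fin n ↪ S}
      {P : Proc} {ρ' : Density S} (hρ' : ρ'.mat = E.applyOn q ρ.mat) :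
      Step ⟨S, ρ, .op t E (fun i => .qubit (q i)) P⟩ .tau (.one t) (SDist.point ⟨S, ρ', P⟩)
  /-- Outcome `m` has the probability `tr (Mₘ ρ Mₘ†)`, and `ρ' m` is the normalization of
  `Mₘ ρ Mₘ†`. An outcome of probability zero does not contribute to `Δ`, and `ρ' m` is then
  irrelevant. -/
  | meas {S : Finset QName} {ρ : Density S} {t : Tag} {n : ℕ} {M : Measurement n}
      {q : Fin n ↪ S} {x : Var} {P : Proc} {ρ' : Fin M.card → Density S}
      (hρ' : ∀ m, (conjOn q (M.op m) ρ.mat).trace • (ρ' m).mat = conjOn q (M.op m) ρ.mat)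
      {Δ : SDist Conf}
      (hΔ : Δ.weight = ∑ m, Finsupp.single (⟨S, ρ' m, P.subst x (.nat m)⟩ : Conf)
        (conjOn q (M.op m) ρ.mat).trace.re.toNNReal) :
      Step ⟨S, ρ, .meas t M (fun i => .qubit (q i)) x P⟩ .tau (.one t) Δ
  | send {S : Finset QName} {ρ : Density S} {t : Tag} {c : Chan} {e : Expr} {v : Value}
      {P : Proc} (he : e.Eval v) :
      Step ⟨S, ρ, .send t c e P⟩ (.send c v) (.one t) (SDist.point ⟨S, ρ, P⟩)
  /-- The received value has the type of the channel; a received qubit is one of the state that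
  is not owned by the process. -/
  | recv {S : Finset QName} {ρ : Density S} {t : Tag} {c : Chan} {x : Var} {v : Value}
      {P : Proc} (hv : v.ty = c.ty) (hq : ∀ q, v = .qubit q → q ∈ S ∧ q ∉ P.owned) :
      Step ⟨S, ρ, .recv t c x P⟩ (.recv c v) (.one t) (SDist.point ⟨S, ρ, P.subst x v⟩)
  | iteT {S : Finset QName} {ρ : Density S} {e : Expr} {P Q : Proc} {μ : Act} {s : Sched}
      {Δ : SDist Conf} (he : e.Eval (.bool true)) :
      Step ⟨S, ρ, P⟩ μ s Δ → Step ⟨S, ρ, .ite e P Q⟩ μ s Δ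
  | iteF {S : Finset QName} {ρ : Density S} {e : Expr} {P Q : Proc} {μ : Act} {s : Sched}
      {Δ : SDist Conf} (he : e.Eval (.bool false)) :
      Step ⟨S, ρ, Q⟩ μ s Δ → Step ⟨S, ρ, .ite e P Q⟩ μ s Δ
  | sumL {S : Finset QName} {ρ : Density S} {P Q : Proc} {μ : Act} {s : Sched}
      {Δ : SDist Conf} :
      Step ⟨S, ρ, P⟩ μ s Δ → Step ⟨S, ρ, .sum P Q⟩ μ s Δ
  | sumR {S : Finset QName} {ρ : Density S} {P Q : Proc} {μ : Act} {s : Sched}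
      {Δ : SDist Conf} :
      Step ⟨S, ρ, Q⟩ μ s Δ → Step ⟨S, ρ, .sum P Q⟩ μ s Δ
  | parL {S : Finset QName} {ρ : Density S} {P Q : Proc} {μ : Act} {s : Sched}
      {Δ : SDist Conf} (hμ : ∀ c q, μ = .recv c (.qubit q) → q ∉ Q.owned) :
      Step ⟨S, ρ, P⟩ μ s Δ →
      Step ⟨S, ρ, .par P Q⟩ μ s (Δ.map fun C => ⟨C.qubits, C.state, .par C.proc Q⟩)
  | parR {S : Finset QName} {ρ : Density S} {P Q : Proc} {μ : Act} {s : Sched}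
      {Δ : SDist Conf} (hμ : ∀ c q, μ = .recv c (.qubit q) → q ∉ P.owned) :
      Step ⟨S, ρ, Q⟩ μ s Δ →
      Step ⟨S, ρ, .par P Q⟩ μ s (Δ.map fun C => ⟨C.qubits, C.state, .par P C.proc⟩)
  | synchL {S : Finset QName} {ρ : Density S} {P Q P' Q' : Proc} {c : Chan} {v : Value}
      {t t' : Tag} :
      Step ⟨S, ρ, P⟩ (.send c v) (.one t) (SDist.point ⟨S, ρ, P'⟩) →
      Step ⟨S, ρ, Q⟩ (.recv c v) (.one t') (SDist.point ⟨S, ρ, Q'⟩) →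
      Step ⟨S, ρ, .par P Q⟩ .tau (.pair t t') (SDist.point ⟨S, ρ, .par P' Q'⟩)
  | synchR {S : Finset QName} {ρ : Density S} {P Q P' Q' : Proc} {c : Chan} {v : Value}
      {t t' : Tag} :
      Step ⟨S, ρ, P⟩ (.recv c v) (.one t) (SDist.point ⟨S, ρ, P'⟩) →
      Step ⟨S, ρ, Q⟩ (.send c v) (.one t') (SDist.point ⟨S, ρ, Q'⟩) →
      Step ⟨S, ρ, .par P Q⟩ .tau (.pair t t') (SDist.point ⟨S, ρ, .par P' Q'⟩)
  | restr {S : Finset QName} {ρ : Density S} {P : Proc} {c : Chan} {μ : Act} {s : Sched}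
      {Δ : SDist Conf} (hμ : ∀ v, μ ≠ .send c v ∧ μ ≠ .recv c v) :
      Step ⟨S, ρ, P⟩ μ s Δ →
      Step ⟨S, ρ, .restr P c⟩ μ s (Δ.map fun C => ⟨C.qubits, C.state, .restr C.proc c⟩)

/-- Whatever the quantum state, a scheduler determines the action and the transition of `P`,
except that an input may be performed with several received values. -/
def Proc.LocallyDeterministic (P : Proc) : Prop :=
  ∀ (C : Conf) (S : Finset QName) (Γ : Set Expr), C.proc = P → C.Typed S Γ →
    ∀ (s : Sched) (μ μ' : Act) (Δ Δ' : SDist Conf), s.tags ⊆ P.tags →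
      Step C μ s Δ → Step C μ' s Δ' →
      (μ = μ' ∧ Δ = Δ') ∨ (μ ≠ μ' ∧ ∃ c v v', μ = .recv c v ∧ μ' = .recv c v')

/-- `P'` is reached from `P` with positive probability by one transition, in some state. -/
def Proc.Succ (P P' : Proc) : Prop :=
  ∃ (C : Conf) (S : Finset QName) (Γ : Set Expr) (μ : Act) (s : Sched) (Δ : SDist Conf),
    C.proc = P ∧ C.Typed S Γ ∧ Step C μ s Δ ∧ ∃ C' ∈ Δ.weight.support, C'.proc = P'

/-- `P` and all the processes into which it may evolve are deterministic. -/
def Proc.Deterministic (P : Proc) : Prop :=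
  ∀ P', Relation.ReflTransGen Proc.Succ P P' → P'.LocallyDeterministic

/-- A configuration evolves to the empty distribution when it has no transition with the given
action and scheduler. -/
def StepBot (μ : Act) (s : Sched) (C : Conf) (Δ : SDist Conf) : Prop :=
  Step C μ s Δ ∨ (Δ = SDist.empty ∧ ¬ ∃ Δ', Step C μ s Δ')

/-- The scheduled semantics of distributions. -/
def DStep (μ : Act) (s : Sched) : SDist Conf → SDist Conf → Prop := Lift (StepBot μ s)

/-! ## Scheduled saturated bisimilarity -/

/-- Contexts, `[·]` and `[·] ∥ R`. -/
inductive Ctx where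
  | hole
  | par (R : Proc)

namespace Ctx

def fill : Ctx → Proc → Proc
  | hole, P => P
  | par R, P => .par P R

/-- `B[Δ]`. -/
noncomputable def apply (B : Ctx) (Δ : SDist Conf) : SDist Conf :=
  Δ.map fun C => ⟨C.qubits, C.state, B.fill C.proc⟩

def tags : Ctx → Set Tag
  | hole => ∅
  | par R => R.tags

/-- `Γ' ⊢ B[·]_Γ`. As all processes, the one of a context is closed and deterministic. -/
def Typed (Γ Γ' : Set Expr) : Ctx → Prop
  | hole => Γ' = Γ
  | par R => Γ ⊆ Γ' ∧ Typing (Γ' \ Γ) R ∧ R.Closed ∧ R.Deterministic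

/-- The context `Γ' ⊢ B[·]_Γ` is compatible with `Δ`. -/
def Compatible (Γ Γ' : Set Expr) (B : Ctx) (Δ : SDist Conf) : Prop :=
  (∃ S : Finset QName, Γ' ⊆ Expr.qubit '' (S : Set QName) ∧ DistTyped S Γ Δ) ∧
    Disjoint (distTags Δ) B.tags

end Ctx

/-- Related distributions have a common type. -/
def WellTypedRel (R : SDist Conf → SDist Conf → Prop) : Prop :=
  ∀ Δ Θ, R Δ Θ → ∃ S Γ, DistTyped S Γ Δ ∧ DistTyped S Γ Θ

def IsScheduledSaturatedBisimulation (R : SDist Conf → SDist Conf → Prop) : Prop :=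
  WellTypedRel R ∧ ∀ Δ Θ, R Δ Θ → Δ.mass = Θ.mass ∧
    ∀ (Γ Γ' : Set Expr) (B : Ctx), B.Typed Γ Γ' →
      B.Compatible Γ Γ' Δ → B.Compatible Γ Γ' Θ → ∀ s : Sched,
        (∀ Δ', DStep .tau s (B.apply Δ) Δ' → ∃ Θ', DStep .tau s (B.apply Θ) Θ' ∧ R Δ' Θ') ∧
        (∀ Θ', DStep .tau s (B.apply Θ) Θ' → ∃ Δ', DStep .tau s (B.apply Δ) Δ' ∧ R Δ' Θ')

/-- The largest scheduled saturated bisimulation: the union of all of them. -/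
def ScheduledSaturatedBisimilar (Δ Θ : SDist Conf) : Prop :=
  ∃ R, IsScheduledSaturatedBisimulation R ∧ R Δ Θ

end LqCCS

namespace LqCCS

/-! ## Operators on named qubits -/

section Quantum

variable {S : Finset QName} {n : ℕ}

/-! To a distribution attach, for every process `P`, the operator `∑ p • ρ` over its configurations
`⟨ρ, P⟩`. This `mixedState` is linear in the weights and valued in `Proc →₀ OpOn S`. The relation
`SameMixedState`, which equates mixed states of distributions of a common type over deterministic
processes, is a bisimulation, and it contains the pair of the theorem.

The decisive point is `Step.exists_linear`. Whether a process can perform an action with a given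
scheduler does not depend on the quantum state, and the mixed state of the target is a linear
function of the source state. For a measurement, the probability of an outcome cancels the
normalization of the state after it, leaving `Mₘ ρ Mₘ†`. Determinism makes the target unique, so the
linear function depends only on the process and the scheduler (`exists_linear_stepBot`). Through the
left-linear lifting, the mixed state after any move is then a fixed linear image of the mixed state
before it. A move always exists, the empty distribution being the fallback, so every move of one
side is matched by an arbitrary move of the other (`exists_dstep`).

Masses agree because the mass is the total trace of the mixed state. A context `[·] ∥ R` relabels
processes without touching states, hence preserves equality of mixed states. It preserves
determinism because the tags of the two sides are disjoint: the scheduler then reveals which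
components moved (`Proc.Deterministic.par`). Preservation of types rests on a substitution lemma
(`Typing.subst`) and on subject reduction (`Step.typing`). -/

theorem embed_conjTranspose (q : Fin n ↪ S) (K : Op n) : (embed q K)ᴴ = embed q Kᴴ := by
  ext a b
  simp only [embed, Matrix.conjTranspose_apply, Matrix.of_apply, apply_ite star, star_zero]
  simp only [eq_comm]

theorem embed_one (q : Fin n ↪ S) : embed q (1 : Op n) = 1 := by
  ext a b
  simp only [embed, Matrix.of_apply, Matrix.one_apply]
  by_cases hab : a = b
  · subst hab; simp
  · rw [if_neg hab]
    split_ifs with h1 h2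
    · refine absurd (funext fun i => ?_) hab
      by_cases hi : i ∈ Set.range q
      · obtain ⟨j, rfl⟩ := hi
        exact congrFun h2 j
      · exact h1 i hi
    · rfl
    · rfl

theorem embed_sum {ι : Type*} [Fintype ι] (q : Fin n ↪ S) (K : ι → Op n) :
    embed q (∑ i, K i) = ∑ i, embed q (K i) := by
  ext a b
  simp only [embed, Matrix.of_apply, Matrix.sum_apply]
  split_ifs <;> simp

/-- In the matrix product, only intermediate assignments that agree with the row `a` off the qubits
`q` contribute. They are the `Function.extend q z a`, with `z` running over the bits on `q`, which
gives the product of the small matrices. -/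
theorem embed_mul (q : Fin n ↪ S) (K L : Op n) : embed q (K * L) = embed q K * embed q L := by
  ext a b
  simp only [embed, Matrix.of_apply, Matrix.mul_apply]
  have key : ∀ z : Fin n → Fin 2, (Function.extend q z a) ∘ q = z := fun z =>
    funext fun i => q.injective.extend_apply z a i
  have off : ∀ (z : Fin n → Fin 2) (i : S), i ∉ Set.range q → Function.extend q z a i = a i :=
    fun z i hi => Function.extend_apply' z a i (by simpa using hi)
  rw [← Fintype.sum_of_injective (fun z : Fin n → Fin 2 => Function.extend q z a)
    (fun z w h => by rw [← key z, ← key w]; exact congrArg (· ∘ q) h)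
    (fun z => if ∀ i, i ∉ Set.range q → a i = b i then K (a ∘ q) z * L z (b ∘ q) else 0)]
  · split_ifs <;> simp
  · intro c hc
    rw [if_neg, zero_mul]
    intro hac
    refine hc ⟨c ∘ q, funext fun i => ?_⟩
    by_cases hi : i ∈ Set.range q
    · obtain ⟨j, rfl⟩ := hi
      exact q.injective.extend_apply _ _ j
    · exact (off _ i hi).trans (hac i hi)
  · intro z
    rw [key, if_pos fun i hi => (off z i hi).symm]
    have : (∀ i, i ∉ Set.range q → Function.extend q z a i = b i) ↔
        ∀ i, i ∉ Set.range q → a i = b i :=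
      forall₂_congr fun i hi => by rw [off z i hi]
    simp only [this, mul_ite, mul_zero]

theorem sum_embed_conjTranspose_mul_self {ι : Type*} [Fintype ι] (q : Fin n ↪ S) (K : ι → Op n)
    (hK : ∑ i, (K i)ᴴ * K i = 1) : ∑ i, (embed q (K i))ᴴ * embed q (K i) = 1 := by
  simp_rw [embed_conjTranspose, ← embed_mul, ← embed_sum, hK, embed_one]

theorem posSemidef_conjOn (q : Fin n ↪ S) (K : Op n) {ρ : OpOn S} (hρ : ρ.PosSemidef) :
    (conjOn q K ρ).PosSemidef :=
  hρ.mul_mul_conjTranspose_same _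

/-- Cyclicity of the trace turns each term into `tr (K† K ρ)`. This gives both trace preservation of
superoperators and total probability one of measurements. -/
theorem sum_trace_conjOn {ι : Type*} [Fintype ι] (q : Fin n ↪ S) (K : ι → Op n)
    (hK : ∑ i, (K i)ᴴ * K i = 1) (ρ : OpOn S) : ∑ i, (conjOn q (K i) ρ).trace = ρ.trace := by
  have h : ∀ i, (conjOn q (K i) ρ).trace = ((embed q (K i))ᴴ * embed q (K i) * ρ).trace :=
    fun i => by rw [conjOn, Matrix.trace_mul_cycle]
  simp_rw [h, ← Matrix.trace_sum, ← Finset.sum_mul, sum_embed_conjTranspose_mul_self q K hK,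
    one_mul]

/-- `ρ ↦ K ρ K†` as a linear map. -/
noncomputable def conjOnLinear (q : Fin n ↪ S) (K : Op n) : OpOn S →ₗ[ℝ≥0] OpOn S where
  toFun := conjOn q K
  map_add' ρ σ := by simp only [conjOn, mul_add, add_mul]
  map_smul' r ρ := by simp only [conjOn, mul_smul_comm, smul_mul_assoc, RingHom.id_apply]

/-- A superoperator applied to a density operator. -/
noncomputable def Superop.applyDensity (E : Superop n) (q : Fin n ↪ S) (ρ : Density S) :
    Density S where
  mat := E.applyOn q ρ.mat
  posSemidef := Matrix.posSemidef_sum _ fun i _ => posSemidef_conjOn q (E.kraus i) ρ.posSemidef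
  trace_eq_one := by
    rw [Superop.applyOn, Matrix.trace_sum, sum_trace_conjOn q E.kraus E.complete, ρ.trace_eq_one]

theorem coe_toNNReal_trace {M : OpOn S} (hM : M.PosSemidef) :
    ((M.trace.re.toNNReal : ℝ) : ℂ) = M.trace := by
  have h := hM.trace_nonneg
  rw [Complex.le_def] at h
  rw [Real.coe_toNNReal _ h.1]
  exact Complex.ext rfl h.2

/-- A positive operator of trace zero vanishes, so an outcome of probability zero accepts any
density operator; `ρ` serves as this default. Otherwise one divides by the trace. -/
theorem exists_density_trace_smul {M : OpOn S} (hM : M.PosSemidef) (ρ : Density S) :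
    ∃ σ : Density S, M.trace • σ.mat = M := by
  by_cases h0 : M.trace = 0
  · exact ⟨ρ, by rw [h0, zero_smul, hM.trace_eq_zero_iff.1 h0]⟩
  · refine ⟨⟨M.trace⁻¹ • M, hM.smul ?_, ?_⟩, ?_⟩
    · exact inv_nonneg.2 hM.trace_nonneg
    · rw [Matrix.trace_smul, smul_eq_mul, inv_mul_cancel₀ h0]
    · exact smul_inv_smul₀ h0 M

end Quantum
/-! ## Supports of distributions -/

namespace SDist

variable {A B : Type}

theorem ext {Δ Θ : SDist A} (h : Δ.weight = Θ.weight) : Δ = Θ := by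
  cases Δ; cases Θ; cases h; rfl

theorem mem_support_point {a b : A} (h : b ∈ (point a).weight.support) : b = a := by
  classical
  simpa using Finsupp.support_single_subset h

theorem exists_of_mem_support_map {f : A → B} {Δ : SDist A} {b : B}
    (h : b ∈ (Δ.map f).weight.support) : ∃ a ∈ Δ.weight.support, f a = b := by
  classical
  simpa using Finsupp.mapDomain_support h

theorem self_mem_support_point (a : A) : a ∈ (point a).weight.support := by
  simp [point]

theorem map_point (f : A → B) (a : A) : (point a).map f = point (f a) :=
  ext Finsupp.mapDomain_single

theorem point_injective : Function.Injective (point : A → SDist A) := fun _ _ h =>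
  Finsupp.single_left_injective one_ne_zero (congrArg SDist.weight h)

end SDist

theorem exists_of_mem_support_sum_single {ι A : Type*} [Fintype ι] {a : ι → A} {p : ι → ℝ≥0} {b : A}
    (h : b ∈ (∑ i, Finsupp.single (a i) (p i)).support) : ∃ i, b = a i := by
  classical
  obtain ⟨i, -, hi⟩ := Finset.mem_biUnion.1 (Finsupp.support_finsetSum h)
  exact ⟨i, by simpa using Finsupp.support_single_subset hi⟩

/-! ## Substitution -/

section Subst

theorem Value.toExpr_ne_var (v : Value) (x : Var) : v.toExpr ≠ .var x := by
  cases v <;> simp [Value.toExpr]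

theorem Expr.fv_subst (x : Var) (v : Value) (e : Expr) : (e.subst x v).fv ⊆ e.fv \ {x} := by
  induction e with
  | var y =>
    by_cases h : y = x
    · cases v <;> simp [Expr.subst, h, Value.toExpr, Expr.fv]
    · simp [Expr.subst, h, Expr.fv, Ne.symm h]
  | bool | nat | qubit => simp [Expr.subst, Expr.fv]
  | not e ih => exact ih
  | or e e' ih ih' | le e e' ih ih' | eq e e' ih ih' =>
    simp only [Expr.subst, Expr.fv, Set.union_sdiff_distrib]
    exact Set.union_subset_union ih ih'

theorem Expr.iUnion_fv_subst {n : ℕ} (x : Var) (v : Value) (es : Fin n → Expr) :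
    (⋃ i, ((es i).subst x v).fv) ⊆ (⋃ i, (es i).fv) \ {x} := by
  rw [Set.iUnion_sdiff]
  exact Set.iUnion_mono fun i => Expr.fv_subst x v (es i)

theorem Proc.fv_subst (x : Var) (v : Value) (P : Proc) : (P.subst x v).fv ⊆ P.fv \ {x} := by
  induction P with
  | nil es => exact Expr.iUnion_fv_subst x v es
  | tau _ _ ih | tauPair _ _ _ ih | restr _ _ ih => exact ih
  | recv t c y P ih =>
    simp only [Proc.subst, Proc.fv]
    split_ifs with h
    · subst h; simp
    · exact fun z hz => ⟨⟨(ih hz.1).1, hz.2⟩, (ih hz.1).2⟩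
  | send t c e P ih =>
    simp only [Proc.subst, Proc.fv, Set.union_sdiff_distrib]
    exact Set.union_subset_union (Expr.fv_subst x v e) ih
  | op t E es P ih =>
    simp only [Proc.subst, Proc.fv, Set.union_sdiff_distrib]
    exact Set.union_subset_union (Expr.iUnion_fv_subst x v es) ih
  | meas t M es y P ih =>
    simp only [Proc.subst, Proc.fv, Set.union_sdiff_distrib]
    refine Set.union_subset_union (Expr.iUnion_fv_subst x v es) ?_
    split_ifs with h
    · subst h; simp
    · exact fun z hz => ⟨⟨(ih hz.1).1, hz.2⟩, (ih hz.1).2⟩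
  | ite e P Q ihP ihQ =>
    simp only [Proc.subst, Proc.fv, Set.union_sdiff_distrib]
    exact Set.union_subset_union (Set.union_subset_union (Expr.fv_subst x v e) ihP) ihQ
  | sum P Q ihP ihQ | par P Q ihP ihQ =>
    simp only [Proc.subst, Proc.fv, Set.union_sdiff_distrib]
    exact Set.union_subset_union ihP ihQ

theorem Proc.tags_subst (x : Var) (v : Value) (P : Proc) : (P.subst x v).tags = P.tags := by
  induction P with
  | nil => rfl
  | recv t c y P ih | meas t M es y P ih =>
    simp only [Proc.subst, Proc.tags]
    split_ifs
    · rfl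
    · rw [ih]
  | _ => simp_all [Proc.subst, Proc.tags]

theorem Expr.HasType.subst {e : Expr} {T : Ty} (h : e.HasType T) {x : Var} {v : Value}
    (hv : v.ty = x.ty) : (e.subst x v).HasType T := by
  induction h with
  | var y =>
    simp only [Expr.subst]
    split_ifs with hy
    · subst hy
      rw [← hv]
      cases v <;> constructor
    · exact .var y
  | bool b => exact .bool b
  | nat n => exact .nat n
  | qubit q => exact .qubit q
  | not _ ih => exact .not ih
  | or _ _ ih ih' => exact .or ih ih'
  | le _ _ ih ih' => exact .le ih ih'
  | eq _ _ ih ih' => exact .eq ih ih'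

theorem Expr.Eval.ty_eq {e : Expr} {v : Value} (h : e.Eval v) {T : Ty} (hT : e.HasType T) :
    v.ty = T := by
  cases h <;> cases hT <;> rfl

theorem Expr.IsQubit.subst {e : Expr} (h : e.IsQubit) {x : Var} {v : Value} (hv : v.ty = x.ty) :
    (e.subst x v).IsQubit := by
  cases e <;> simp only [Expr.IsQubit] at h
  case var y =>
    simp only [Expr.subst]
    split_ifs with hy
    · subst hy
      rw [h] at hv
      cases v <;> simp_all [Value.ty, Value.toExpr, Expr.IsQubit]
    · exact h
  case qubit => trivial

theorem Expr.IsQubit.subst_of_ne {e : Expr} (h : e.IsQubit) {x : Var} (v : Value)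
    (he : e ≠ .var x) : e.subst x v = e := by
  cases e <;> simp only [Expr.IsQubit] at h
  case var y =>
    rw [Expr.subst, if_neg]
    rintro rfl
    exact he rfl
  case qubit => rfl

theorem Typing.isQubit {Γ : Set Expr} {P : Proc} (h : Typing Γ P) : ∀ e ∈ Γ, e.IsQubit := by
  induction h with
  | nil hes _ => rintro _ ⟨i, rfl⟩; exact hes i
  | qrecv _ _ _ _ ih => exact fun e he => ih e (Or.inl he)
  | @qsend _ _ _ e' _ _ hq _ _ ih =>
    intro e he
    by_cases h : e = e'
    · exact h ▸ hq
    · exact ih e ⟨he, h⟩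
  | par _ _ _ ih ih' => exact fun e he => he.elim (ih e) (ih' e)
  | ite _ _ _ ih _ | sum _ _ ih _ => exact ih
  | tau _ ih | tauPair _ ih | op _ _ _ ih | meas _ _ _ _ ih | crecv _ _ _ ih | csend _ _ _ ih
  | restr _ ih => exact ih

/-- Among qubit expressions only `x` is moved, and it goes to a value outside `Γ`. -/
theorem Expr.injOn_subst {Γ : Set Expr} (hΓ : ∀ e ∈ Γ, e.IsQubit) {x : Var} {v : Value}
    (hv : v.toExpr ∉ Γ) : Set.InjOn (Expr.subst x v) Γ := by
  intro e he e' he' h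
  by_cases hx : e = .var x <;> by_cases hx' : e' = .var x
  · rw [hx, hx']
  · rw [(hΓ e' he').subst_of_ne v hx', hx, Expr.subst, if_pos rfl] at h
    exact absurd (h ▸ he') hv
  · rw [(hΓ e he).subst_of_ne v hx, hx', Expr.subst, if_pos rfl] at h
    exact absurd (h ▸ he) hv
  · rwa [(hΓ e he).subst_of_ne v hx, (hΓ e' he').subst_of_ne v hx'] at h

theorem Expr.image_subst_of_notMem {Γ : Set Expr} (hΓ : ∀ e ∈ Γ, e.IsQubit) {x : Var} (v : Value)
    (hx : Expr.var x ∉ Γ) : Expr.subst x v '' Γ = Γ := by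
  have : Set.EqOn (Expr.subst x v) id Γ := fun e he =>
    (hΓ e he).subst_of_ne v fun h => hx (h ▸ he)
  rw [this.image_eq, Set.image_id]

/-- Freshness of `v` keeps the substitution injective on the owned qubits, so distinctness of
arguments, disjointness of parallel components and removal of a sent qubit survive it. -/
theorem Typing.subst {Γ : Set Expr} {P : Proc} (h : Typing Γ P) {x : Var} {v : Value}
    (hv : v.ty = x.ty) (hfresh : v.toExpr ∉ Γ) :
    Typing (Expr.subst x v '' Γ) (P.subst x v) := by
  have inj {Γ : Set Expr} {P : Proc} (h : Typing Γ P) (hf : v.toExpr ∉ Γ) :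
    Set.InjOn (Expr.subst x v) Γ := Expr.injOn_subst h.isQubit hf
  have comp {Γ : Set Expr} {P : Proc} (h : Typing Γ P) (hf : v.toExpr ∉ Γ) {n : ℕ}
      {es : Fin n → Expr} (hinj : Function.Injective es) (hes : Set.range es ⊆ Γ) :
      Function.Injective fun i => (es i).subst x v := fun i j hij =>
    hinj (inj h hf (hes ⟨i, rfl⟩) (hes ⟨j, rfl⟩) hij)
  have rng {Γ : Set Expr} {n : ℕ} {es : Fin n → Expr} (hes : Set.range es ⊆ Γ) :
      Set.range (fun i => (es i).subst x v) ⊆ Expr.subst x v '' Γ := by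
    rintro _ ⟨i, rfl⟩
    exact ⟨es i, hes ⟨i, rfl⟩, rfl⟩
  induction h with
  | @nil n es hes hinj =>
    rw [← Set.range_comp]
    exact .nil (fun i => (hes i).subst hv) (comp (.nil hes hinj) hfresh hinj subset_rfl)
  | tau _ ih => exact .tau (ih hfresh)
  | tauPair _ ih => exact .tauPair (ih hfresh)
  | op hinj hes h ih => exact .op (comp h hfresh hinj hes) (rng hes) (ih hfresh)
  | meas hinj hes hx h ih =>
    refine .meas (comp h hfresh hinj hes) (rng hes) hx ?_
    -- If the bound variable is `x`, the body is untouched; `x` has type `nat`, so it is not in `Γ`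
    -- and the substitution fixes `Γ`.
    split_ifs with hy
    · rw [Expr.image_subst_of_notMem h.isQubit]
      · exact h
      · subst hy
        intro hm
        have := h.isQubit _ hm
        simp [Expr.IsQubit, hx] at this
    · exact ih hfresh
  | crecv hc hx h ih =>
    refine .crecv hc hx ?_
    split_ifs with hy
    · rw [Expr.image_subst_of_notMem h.isQubit]
      · exact h
      · subst hy
        exact fun hm => hc (hx ▸ h.isQubit _ hm)
    · exact ih hfresh
  | @qrecv Γ t c y P hc hx hf h ih =>
    have hΓ : ∀ e ∈ Γ, e.IsQubit := fun e he => h.isQubit e (Or.inl he)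
    -- The bound variable stays fresh: values are not variables, and the other members of `Γ` do not
    -- change.
    have hne (e) (he : e ∈ Γ) : e.subst x v ≠ .var y := by
      intro heq
      by_cases hex : e = .var x
      · rw [hex, Expr.subst, if_pos rfl] at heq
        exact v.toExpr_ne_var y heq
      · rw [(hΓ e he).subst_of_ne v hex] at heq
        exact hf (heq ▸ he)
    refine .qrecv hc hx (fun ⟨e, he, heq⟩ => hne e he heq) ?_
    split_ifs with hy
    · subst hy
      rwa [Expr.image_subst_of_notMem hΓ v hf]
    · have := ih (by
        rintro (hm | hm)
        · exact hfresh hm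
        · exact v.toExpr_ne_var y hm)
      rwa [Set.image_union, Set.image_singleton, Expr.subst, if_neg hy] at this
  | csend hc he _ ih => exact .csend hc (he.subst hv) (ih hfresh)
  | @qsend Γ t c e P hc hq he h ih =>
    refine .qsend hc (hq.subst hv) ⟨e, he, rfl⟩ ?_
    have hinj := inj (Typing.qsend (t := t) hc hq he h) hfresh
    have hs : ({e} : Set Expr) ⊆ Γ := by simpa using he
    have := ih fun hm => hfresh hm.1
    rwa [hinj.image_sdiff_subset hs, Set.image_singleton] at this
  | ite he _ _ ih ih' => exact .ite (he.subst hv) (ih hfresh) (ih' hfresh)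
  | sum _ _ ih ih' => exact .sum (ih hfresh) (ih' hfresh)
  | @par Γ Γ' P Q hd h h' ih ih' =>
    rw [Set.image_union]
    refine .par ?_ (ih fun hm => hfresh (Or.inl hm)) (ih' fun hm => hfresh (Or.inr hm))
    have hinj := inj (Typing.par hd h h') hfresh
    exact hd.image hinj Set.subset_union_left Set.subset_union_right
  | restr _ ih => exact .restr (ih hfresh)

end Subst

/-! ## Transitions and types -/

/-- The qubits owned by a process of type `Γ` after an action. -/
def Act.residual (Γ : Set Expr) : Act → Set Expr
  | .send _ (.qubit q) => Γ \ {.qubit q}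
  | .recv _ (.qubit q) => Γ ∪ {.qubit q}
  | _ => Γ

theorem Step.fv_subset {C : Conf} {μ : Act} {s : Sched} {Δ : SDist Conf} (h : Step C μ s Δ) :
    ∀ C' ∈ Δ.weight.support, C'.proc.fv ⊆ C.proc.fv := by
  induction h with
  | tau | tauPair =>
    intro C' hC'
    rw [SDist.mem_support_point hC']
    exact subset_rfl
  | op | send =>
    intro C' hC'
    rw [SDist.mem_support_point hC']
    exact Set.subset_union_right
  | meas _ hΔ =>
    intro C' hC'
    rw [hΔ] at hC'
    obtain ⟨m, rfl⟩ := exists_of_mem_support_sum_single hC'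
    exact (Proc.fv_subst _ _ _).trans Set.subset_union_right
  | recv =>
    intro C' hC'
    rw [SDist.mem_support_point hC']
    exact Proc.fv_subst _ _ _
  | iteT _ _ ih => exact fun C' hC' => (ih C' hC').trans fun _ hz => .inl (.inr hz)
  | iteF _ _ ih => exact fun C' hC' => (ih C' hC').trans Set.subset_union_right
  | sumL _ ih => exact fun C' hC' => (ih C' hC').trans Set.subset_union_left
  | sumR _ ih => exact fun C' hC' => (ih C' hC').trans Set.subset_union_right
  | parL _ _ ih =>
    intro C' hC'
    obtain ⟨D, hD, rfl⟩ := SDist.exists_of_mem_support_map hC'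
    exact Set.union_subset_union_left _ (ih D hD)
  | parR _ _ ih =>
    intro C' hC'
    obtain ⟨D, hD, rfl⟩ := SDist.exists_of_mem_support_map hC'
    exact Set.union_subset_union_right _ (ih D hD)
  | synchL _ _ ih ih' | synchR _ _ ih ih' =>
    intro C' hC'
    rw [SDist.mem_support_point hC']
    exact Set.union_subset_union (ih _ (SDist.self_mem_support_point _)) (ih' _ (SDist.self_mem_support_point _))
  | restr _ _ ih =>
    intro C' hC'
    obtain ⟨D, hD, rfl⟩ := SDist.exists_of_mem_support_map hC'
    exact ih D hD

theorem Step.tags_subset {C : Conf} {μ : Act} {s : Sched} {Δ : SDist Conf} (h : Step C μ s Δ) :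
    ∀ C' ∈ Δ.weight.support, C'.proc.tags ⊆ C.proc.tags := by
  induction h with
  | tau | tauPair | op | send =>
    intro C' hC'
    rw [SDist.mem_support_point hC']
    exact Set.subset_union_right
  | meas _ hΔ =>
    intro C' hC'
    rw [hΔ] at hC'
    obtain ⟨m, rfl⟩ := exists_of_mem_support_sum_single hC'
    exact (Proc.tags_subst _ _ _).subset.trans Set.subset_union_right
  | recv =>
    intro C' hC'
    rw [SDist.mem_support_point hC']
    exact (Proc.tags_subst _ _ _).subset.trans Set.subset_union_right
  | iteT _ _ ih | sumL _ ih => exact fun C' hC' => (ih C' hC').trans Set.subset_union_left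
  | iteF _ _ ih | sumR _ ih => exact fun C' hC' => (ih C' hC').trans Set.subset_union_right
  | parL _ _ ih =>
    intro C' hC'
    obtain ⟨D, hD, rfl⟩ := SDist.exists_of_mem_support_map hC'
    exact Set.union_subset_union_left _ (ih D hD)
  | parR _ _ ih =>
    intro C' hC'
    obtain ⟨D, hD, rfl⟩ := SDist.exists_of_mem_support_map hC'
    exact Set.union_subset_union_right _ (ih D hD)
  | synchL _ _ ih ih' | synchR _ _ ih ih' =>
    intro C' hC'
    rw [SDist.mem_support_point hC']
    exact Set.union_subset_union (ih _ (SDist.self_mem_support_point _)) (ih' _ (SDist.self_mem_support_point _))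
  | restr _ _ ih =>
    intro C' hC'
    obtain ⟨D, hD, rfl⟩ := SDist.exists_of_mem_support_map hC'
    exact ih D hD

/-- When parallel components have disjoint tags, this identifies from the scheduler the components
that took part. -/
theorem Step.sched_tags_subset {C : Conf} {μ : Act} {s : Sched} {Δ : SDist Conf}
    (h : Step C μ s Δ) : s.tags ⊆ C.proc.tags := by
  induction h with
  | tau | tauPair | op | meas | send | recv => exact Set.subset_union_left
  | iteT _ _ ih | sumL _ ih | parL _ _ ih => exact ih.trans Set.subset_union_left
  | iteF _ _ ih | sumR _ ih | parR _ _ ih => exact ih.trans Set.subset_union_right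
  | synchL _ _ ih ih' | synchR _ _ ih ih' =>
    rintro _ (rfl | rfl)
    · exact .inl (ih rfl)
    · exact .inr (ih' rfl)
  | restr _ _ ih => exact ih

theorem Sched.tags_nonempty (s : Sched) : s.tags.Nonempty := by
  cases s with
  | one t => exact ⟨t, rfl⟩
  | pair t t' => exact ⟨t, .inl rfl⟩

/-- Subject reduction. It covers visible actions because synchronization combines two of them: the
sent qubit is owned by the sender, leaves its type and joins the receiver's, so the union of the two
types is unchanged. -/
theorem Step.typing {C : Conf} {μ : Act} {s : Sched} {Δ : SDist Conf} (h : Step C μ s Δ)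
    {Γ : Set Expr} (hΓ : Typing Γ C.proc) :
    (∀ c q, μ = .send c (.qubit q) → Expr.qubit q ∈ Γ) ∧
    (∀ c q, μ = .recv c (.qubit q) → Expr.qubit q ∉ Γ) ∧
    ∀ C' ∈ Δ.weight.support, C'.qubits = C.qubits ∧ Typing (μ.residual Γ) C'.proc := by
  induction h generalizing Γ with
  | tau | tauPair =>
    refine ⟨nofun, nofun, fun C' hC' => ?_⟩
    rw [SDist.mem_support_point hC']
    cases hΓ
    exact ⟨rfl, by assumption⟩
  | op =>
    refine ⟨nofun, nofun, fun C' hC' => ?_⟩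
    rw [SDist.mem_support_point hC']
    cases hΓ
    exact ⟨rfl, by assumption⟩
  | meas _ hΔ =>
    refine ⟨nofun, nofun, fun C' hC' => ?_⟩
    rw [hΔ] at hC'
    obtain ⟨m, rfl⟩ := exists_of_mem_support_sum_single hC'
    cases hΓ with | meas hinj hes hx h => ?_
    refine ⟨rfl, ?_⟩
    have := h.subst (x := _) (v := .nat m) hx.symm fun hm => h.isQubit _ hm
    rwa [Expr.image_subst_of_notMem h.isQubit] at this
    intro hm
    have := h.isQubit _ hm
    simp [Expr.IsQubit, hx] at this
  | @send S ρ t c e v P he =>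
    cases hΓ with
    | csend hc hT h =>
      have hty := he.ty_eq hT
      refine ⟨fun c q hμ => ?_, nofun, fun C' hC' => ?_⟩
      · cases hμ
        exact absurd hty.symm hc
      · rw [SDist.mem_support_point hC']
        refine ⟨rfl, ?_⟩
        cases v
        · exact h
        · exact h
        · exact absurd hty.symm hc
    | qsend hc hq hm h =>
      -- An expression that is both a qubit expression and evaluable is a qubit name.
      cases he <;> simp only [Expr.IsQubit] at hq
      refine ⟨fun c q hμ => ?_, nofun, fun C' hC' => ?_⟩
      · cases hμ
        exact hm
      · rw [SDist.mem_support_point hC']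
        exact ⟨rfl, h⟩
  | @recv S ρ t c x v P hv hq =>
    cases hΓ with
    | crecv hc hx h =>
      have hvc : v.ty ≠ .qubit := hv ▸ hc
      refine ⟨nofun, fun c q hμ => ?_, fun C' hC' => ?_⟩
      · cases hμ
        exact absurd rfl hvc
      · rw [SDist.mem_support_point hC']
        refine ⟨rfl, ?_⟩
        have hxΓ : Expr.var x ∉ Γ := fun hm => hc (hx ▸ h.isQubit _ hm)
        have := h.subst (hv.trans hx.symm) fun hm => by
          have := h.isQubit _ hm
          cases v <;> simp_all [Value.toExpr, Expr.IsQubit, Value.ty]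
        rw [Expr.image_subst_of_notMem h.isQubit v hxΓ] at this
        cases v
        · exact this
        · exact this
        · exact absurd rfl hvc
    | qrecv hc hx hf h =>
      cases v with
      | nat | bool => rw [hc] at hv; cases hv
      | qubit q =>
        have hqΓ : Expr.qubit q ∉ Γ := fun hm => (hq q rfl).2 ⟨_, h, Or.inl hm⟩
        refine ⟨nofun, fun c q' hμ => ?_, fun C' hC' => ?_⟩
        · cases hμ
          exact hqΓ
        · rw [SDist.mem_support_point hC']
          refine ⟨rfl, ?_⟩
          have := h.subst (x := x) (v := .qubit q) (hv.trans (hc.trans hx.symm)) (by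
            rintro (hm | hm)
            · exact hqΓ hm
            · exact absurd hm (by simp [Value.toExpr]))
          rwa [Set.image_union, Set.image_singleton,
            Expr.image_subst_of_notMem (fun e he => h.isQubit e (.inl he)) _ hf, Expr.subst,
            if_pos rfl] at this
  | iteT _ _ ih => cases hΓ with | ite _ h _ => exact ih h
  | iteF _ _ ih => cases hΓ with | ite _ _ h => exact ih h
  | sumL _ ih => cases hΓ with | sum h _ => exact ih h
  | sumR _ ih => cases hΓ with | sum _ h => exact ih h
  | @parL S ρ P Q μ s Δ hμ _ ih =>
    cases hΓ with | @par Γ₁ Γ₂ _ _ hd h₁ h₂ => ?_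
    obtain ⟨hs, hr, hC⟩ := ih h₁
    have hr' : ∀ c q, μ = .recv c (.qubit q) → Expr.qubit q ∉ Γ₂ := fun c q h hm =>
      hμ c q h ⟨_, h₂, hm⟩
    refine ⟨fun c q h => .inl (hs c q h), fun c q h hm => hm.elim (hr c q h) (hr' c q h),
      fun C' hC' => ?_⟩
    obtain ⟨D, hD, rfl⟩ := SDist.exists_of_mem_support_map hC'
    refine ⟨(hC D hD).1, ?_⟩
    have hD' := (hC D hD).2
    rcases μ with _ | ⟨c, _ | _ | q⟩ | ⟨c, _ | _ | q⟩
    · exact .par hd hD' h₂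
    · exact .par hd hD' h₂
    · exact .par hd hD' h₂
    -- The sent qubit is not owned by the other component, so removing it from one component is
    -- removing it from the union.
    · have hq := Set.disjoint_left.1 hd (hs c q rfl)
      have := Typing.par (hd.mono_left Set.sdiff_subset) hD' h₂
      rwa [← Set.sdiff_singleton_eq_self hq, ← Set.union_sdiff_distrib] at this
    · exact .par hd hD' h₂
    · exact .par hd hD' h₂
    · have hq := hr' c q rfl
      have := Typing.par (Set.disjoint_union_left.2 ⟨hd, Set.disjoint_singleton_left.2 hq⟩) hD' h₂
      rwa [Set.union_right_comm] at this
  | @parR S ρ P Q μ s Δ hμ _ ih =>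
    cases hΓ with | @par Γ₁ Γ₂ _ _ hd h₁ h₂ => ?_
    obtain ⟨hs, hr, hC⟩ := ih h₂
    have hr' : ∀ c q, μ = .recv c (.qubit q) → Expr.qubit q ∉ Γ₁ := fun c q h hm =>
      hμ c q h ⟨_, h₁, hm⟩
    refine ⟨fun c q h => .inr (hs c q h), fun c q h hm => hm.elim (hr' c q h) (hr c q h),
      fun C' hC' => ?_⟩
    obtain ⟨D, hD, rfl⟩ := SDist.exists_of_mem_support_map hC'
    refine ⟨(hC D hD).1, ?_⟩
    have hD' := (hC D hD).2
    rcases μ with _ | ⟨c, _ | _ | q⟩ | ⟨c, _ | _ | q⟩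
    · exact .par hd h₁ hD'
    · exact .par hd h₁ hD'
    · exact .par hd h₁ hD'
    · have hq := Set.disjoint_right.1 hd (hs c q rfl)
      have := Typing.par (hd.mono_right Set.sdiff_subset) h₁ hD'
      rwa [← Set.sdiff_singleton_eq_self hq, ← Set.union_sdiff_distrib] at this
    · exact .par hd h₁ hD'
    · exact .par hd h₁ hD'
    · have hq := hr' c q rfl
      have := Typing.par (Set.disjoint_union_right.2 ⟨hd, Set.disjoint_singleton_right.2 hq⟩) h₁ hD'
      rwa [← Set.union_assoc] at this
  | @synchL S ρ P Q P' Q' c v t t' _ _ ih ih' =>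
    cases hΓ with | @par Γ₁ Γ₂ _ _ hd h₁ h₂ => ?_
    obtain ⟨hs, -, hC⟩ := ih h₁
    obtain ⟨-, -, hC'⟩ := ih' h₂
    have hP := (hC _ (SDist.self_mem_support_point _)).2
    have hQ := (hC' _ (SDist.self_mem_support_point _)).2
    refine ⟨nofun, nofun, fun C' hC' => ?_⟩
    rw [SDist.mem_support_point hC']
    refine ⟨rfl, ?_⟩
    rcases v with _ | _ | q
    · exact .par hd hP hQ
    · exact .par hd hP hQ
    · have hq := hs c q rfl
      have := Typing.par (Set.disjoint_union_right.2
        ⟨hd.mono_left Set.sdiff_subset, Set.disjoint_sdiff_left⟩) hP hQ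
      rwa [← Set.union_assoc, Set.union_right_comm, Set.sdiff_union_of_subset (by simpa using hq)]
        at this
  | @synchR S ρ P Q P' Q' c v t t' _ _ ih ih' =>
    cases hΓ with | @par Γ₁ Γ₂ _ _ hd h₁ h₂ => ?_
    obtain ⟨-, -, hC⟩ := ih h₁
    obtain ⟨hs, -, hC'⟩ := ih' h₂
    have hP := (hC _ (SDist.self_mem_support_point _)).2
    have hQ := (hC' _ (SDist.self_mem_support_point _)).2
    refine ⟨nofun, nofun, fun C' hC' => ?_⟩
    rw [SDist.mem_support_point hC']
    refine ⟨rfl, ?_⟩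
    rcases v with _ | _ | q
    · exact .par hd hP hQ
    · exact .par hd hP hQ
    · have hq := hs c q rfl
      have := Typing.par (Set.disjoint_union_left.2
        ⟨hd.mono_right Set.sdiff_subset, Set.disjoint_sdiff_right⟩) hP hQ
      rwa [Set.union_assoc, Set.union_sdiff_cancel (by simpa using hq)] at this
  | restr _ _ ih =>
    cases hΓ with | restr h => ?_
    obtain ⟨hs, hr, hC⟩ := ih h
    refine ⟨hs, hr, fun C' hC' => ?_⟩
    obtain ⟨D, hD, rfl⟩ := SDist.exists_of_mem_support_map hC'
    exact ⟨(hC D hD).1, .restr (hC D hD).2⟩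

theorem Conf.Typed.step {S : Finset QName} {Γ : Set Expr} {C : Conf} (hC : C.Typed S Γ)
    {s : Sched} {Δ : SDist Conf} (h : Step C .tau s Δ) :
    ∀ C' ∈ Δ.weight.support, C'.Typed S Γ := by
  intro C' hC'
  obtain ⟨hS, hΓ, hcl, hT⟩ := hC
  obtain ⟨hS', hT'⟩ := (h.typing hT).2.2 C' hC'
  exact ⟨hS'.trans hS, hΓ, Set.subset_eq_empty (h.fv_subset C' hC') hcl, hT'⟩

/-! ## The mixed state of every process -/

/-- The state of a configuration, seen as an operator on the qubits `S` (zero if the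
configuration has other qubits). -/
noncomputable def Conf.stateOn (S : Finset QName) (C : Conf) : OpOn S :=
  if h : C.qubits = S then h ▸ C.state.mat else 0

@[simp] theorem Conf.stateOn_mk {S : Finset QName} (ρ : Density S) (P : Proc) :
    (⟨S, ρ, P⟩ : Conf).stateOn S = ρ.mat := by
  simp [Conf.stateOn]

theorem Conf.stateOn_map (S : Finset QName) (C : Conf) (P : Proc) :
    (⟨C.qubits, C.state, P⟩ : Conf).stateOn S = C.stateOn S := rfl

theorem Conf.trace_stateOn {S : Finset QName} {C : Conf} (h : C.qubits = S) :
    (C.stateOn S).trace = 1 := by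
  subst h
  rw [← C.state.trace_eq_one]
  exact congrArg Matrix.trace (Conf.stateOn_mk C.state C.proc)

/-- The mixed states of a distribution, one for every process that occurs in it. -/
noncomputable def mixedState (S : Finset QName) :
    (Conf →₀ ℝ≥0) →ₗ[ℝ≥0] (Proc →₀ OpOn S) :=
  Finsupp.linearCombination ℝ≥0 fun C => Finsupp.single C.proc (C.stateOn S)

theorem mixedState_single (S : Finset QName) (C : Conf) (p : ℝ≥0) :
    mixedState S (Finsupp.single C p) = Finsupp.single C.proc (p • C.stateOn S) := by
  rw [mixedState, Finsupp.linearCombination_single, Finsupp.smul_single]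

theorem mixedState_point {S : Finset QName} (ρ : Density S) (P : Proc) :
    mixedState S (SDist.point ⟨S, ρ, P⟩).weight = Finsupp.single P ρ.mat := by
  rw [SDist.point, mixedState_single, one_smul, Conf.stateOn_mk]

/-- Relabelling processes leaves the states alone, and states whose processes become equal are added
on both sides. By linearity it suffices to check single configurations. -/
theorem mixedState_map (S : Finset QName) (f : Proc → Proc) (Δ : SDist Conf) :
    mixedState S (Δ.map fun C => ⟨C.qubits, C.state, f C.proc⟩).weight =
      Finsupp.lmapDomain (OpOn S) ℝ≥0 f (mixedState S Δ.weight) := by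
  have h : mixedState S ∘ₗ Finsupp.lmapDomain ℝ≥0 ℝ≥0
      (fun C : Conf => (⟨C.qubits, C.state, f C.proc⟩ : Conf)) =
      Finsupp.lmapDomain (OpOn S) ℝ≥0 f ∘ₗ mixedState S := by
    refine Finsupp.lhom_ext fun C p => ?_
    simp only [LinearMap.comp_apply, Finsupp.lmapDomain_apply, Finsupp.mapDomain_single,
      mixedState_single, Conf.stateOn_map]
  exact LinearMap.congr_fun h Δ.weight

/-! ## Transitions are uniform and linear in the state -/

/-- Only `τ` moves act on the state. The same `P'` serves for every state, as needed for both
partners of a synchronization. -/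
theorem Step.visible {C : Conf} {μ : Act} {s : Sched} {Δ : SDist Conf} (h : Step C μ s Δ)
    (hμ : μ ≠ .tau) : ∃ P', ∀ ρ : Density C.qubits,
      Step ⟨C.qubits, ρ, C.proc⟩ μ s (SDist.point ⟨C.qubits, ρ, P'⟩) := by
  induction h with
  | tau | tauPair | op | meas | synchL | synchR => exact absurd rfl hμ
  | send he => exact ⟨_, fun ρ => .send he⟩
  | recv hv hq => exact ⟨_, fun ρ => .recv hv hq⟩
  | iteT he _ ih =>
    obtain ⟨P', h⟩ := ih hμ
    exact ⟨P', fun ρ => .iteT he (h ρ)⟩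
  | iteF he _ ih =>
    obtain ⟨P', h⟩ := ih hμ
    exact ⟨P', fun ρ => .iteF he (h ρ)⟩
  | sumL _ ih =>
    obtain ⟨P', h⟩ := ih hμ
    exact ⟨P', fun ρ => .sumL (h ρ)⟩
  | sumR _ ih =>
    obtain ⟨P', h⟩ := ih hμ
    exact ⟨P', fun ρ => .sumR (h ρ)⟩
  | @parL S _ P Q μ s Δ hr _ ih =>
    obtain ⟨P', h⟩ := ih hμ
    refine ⟨.par P' Q, fun ρ => ?_⟩
    have := Step.parL hr (h ρ)
    rwa [SDist.map_point] at this
  | @parR S _ P Q μ s Δ hr _ ih =>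
    obtain ⟨P', h⟩ := ih hμ
    refine ⟨.par P P', fun ρ => ?_⟩
    have := Step.parR hr (h ρ)
    rwa [SDist.map_point] at this
  | @restr S _ P c μ s Δ hr _ ih =>
    obtain ⟨P', h⟩ := ih hμ
    refine ⟨.restr P' c, fun ρ => ?_⟩
    have := Step.restr hr (h ρ)
    rwa [SDist.map_point] at this

/-- Each outcome enters with its probability times its normalized state, that is with `Mₘ ρ Mₘ†`.
The nonlinear normalization thus disappears from the mixed state. -/
theorem exists_step_meas {S : Finset QName} (ρ : Density S) (t : Tag) {n : ℕ} (M : Measurement n)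
    (q : Fin n ↪ S) (x : Var) (P : Proc) :
    ∃ Δ, Step ⟨S, ρ, .meas t M (fun i => .qubit (q i)) x P⟩ .tau (.one t) Δ ∧
      mixedState S Δ.weight =
        ∑ m : Fin M.card, Finsupp.single (P.subst x (.nat m)) (conjOn q (M.op m) ρ.mat) := by
  have hpos := fun m => posSemidef_conjOn q (M.op m) ρ.posSemidef
  choose ρ' hρ' using fun m => exists_density_trace_smul (hpos m) ρ
  have hsum : ∑ m, (conjOn q (M.op m) ρ.mat).trace.re.toNNReal = 1 := by
    have h : ((∑ m, (conjOn q (M.op m) ρ.mat).trace.re.toNNReal : ℝ≥0) : ℂ) = 1 := by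
      push_cast
      rw [Finset.sum_congr rfl fun m _ => coe_toNNReal_trace (hpos m),
        sum_trace_conjOn q M.op M.complete, ρ.trace_eq_one]
    exact_mod_cast h
  refine ⟨SDist.mix _ _ hsum.le, Step.meas hρ' rfl, ?_⟩
  rw [SDist.mix, map_sum]
  refine Finset.sum_congr rfl fun m _ => ?_
  rw [mixedState_single, Conf.stateOn_mk]
  congr 1
  conv_rhs => rw [← hρ' m, ← coe_toNNReal_trace (hpos m)]
  rfl

/-- No side condition of the rules mentions the state, so a derivation can be replayed in any other
state. Superoperators and measurements contribute linear maps, and the remaining prefixes and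
synchronizations contribute the inclusion at the new process. Parallel composition and restriction
act by relabelling. The scalars are `ℝ≥0` because they are the weights of distributions. -/
theorem Step.exists_linear {C : Conf} {μ : Act} {s : Sched} {Δ : SDist Conf}
    (h : Step C μ s Δ) : ∃ L : OpOn C.qubits →ₗ[ℝ≥0] (Proc →₀ OpOn C.qubits),
      ∀ ρ : Density C.qubits, ∃ Δ', Step ⟨C.qubits, ρ, C.proc⟩ μ s Δ' ∧
        mixedState C.qubits Δ'.weight = L ρ.mat := by
  induction h with
  | @tau S _ t P => exact ⟨Finsupp.lsingle P, fun ρ => ⟨_, .tau, mixedState_point ρ P⟩⟩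
  | @tauPair S _ t t' P =>
    exact ⟨Finsupp.lsingle P, fun ρ => ⟨_, .tauPair, mixedState_point ρ P⟩⟩
  | @op S _ t n E q P _ _ =>
    refine ⟨Finsupp.lsingle P ∘ₗ ∑ i, conjOnLinear q (E.kraus i), fun ρ =>
      ⟨_, .op (ρ' := E.applyDensity q ρ) rfl, ?_⟩⟩
    rw [mixedState_point, LinearMap.comp_apply, LinearMap.sum_apply]
    rfl
  | @meas S _ t n M q x P _ _ _ _ =>
    refine ⟨∑ m : Fin M.card, Finsupp.lsingle (P.subst x (.nat m)) ∘ₗ conjOnLinear q (M.op m),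
      fun ρ => ?_⟩
    obtain ⟨Δ, h, hΔ⟩ := exists_step_meas ρ t M q x P
    refine ⟨Δ, h, hΔ.trans ?_⟩
    rw [LinearMap.sum_apply]
    rfl
  | @send S _ t c e v P he =>
    exact ⟨Finsupp.lsingle P, fun ρ => ⟨_, .send he, mixedState_point ρ P⟩⟩
  | @recv S _ t c x v P hv hq =>
    exact ⟨Finsupp.lsingle _, fun ρ => ⟨_, .recv hv hq, mixedState_point ρ _⟩⟩
  | iteT he _ ih =>
    obtain ⟨L, h⟩ := ih
    exact ⟨L, fun ρ => (h ρ).imp fun _ hΔ => ⟨.iteT he hΔ.1, hΔ.2⟩⟩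
  | iteF he _ ih =>
    obtain ⟨L, h⟩ := ih
    exact ⟨L, fun ρ => (h ρ).imp fun _ hΔ => ⟨.iteF he hΔ.1, hΔ.2⟩⟩
  | sumL _ ih =>
    obtain ⟨L, h⟩ := ih
    exact ⟨L, fun ρ => (h ρ).imp fun _ hΔ => ⟨.sumL hΔ.1, hΔ.2⟩⟩
  | sumR _ ih =>
    obtain ⟨L, h⟩ := ih
    exact ⟨L, fun ρ => (h ρ).imp fun _ hΔ => ⟨.sumR hΔ.1, hΔ.2⟩⟩
  | @parL S _ P Q μ s Δ hr _ ih =>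
    obtain ⟨L, h⟩ := ih
    refine ⟨Finsupp.lmapDomain (OpOn S) ℝ≥0 (fun P => .par P Q) ∘ₗ L, fun ρ => ?_⟩
    obtain ⟨Δ', h', hΔ'⟩ := h ρ
    refine ⟨_, .parL hr h', ?_⟩
    rw [LinearMap.comp_apply, ← hΔ']
    exact mixedState_map S (fun P => .par P Q) Δ'
  | @parR S _ P Q μ s Δ hr _ ih =>
    obtain ⟨L, h⟩ := ih
    refine ⟨Finsupp.lmapDomain (OpOn S) ℝ≥0 (fun Q => .par P Q) ∘ₗ L, fun ρ => ?_⟩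
    obtain ⟨Δ', h', hΔ'⟩ := h ρ
    refine ⟨_, .parR hr h', ?_⟩
    rw [LinearMap.comp_apply, ← hΔ']
    exact mixedState_map S (fun Q => .par P Q) Δ'
  | synchL h h' _ _ =>
    obtain ⟨P', hP⟩ := h.visible nofun
    obtain ⟨Q', hQ⟩ := h'.visible nofun
    exact ⟨Finsupp.lsingle (.par P' Q'), fun ρ =>
      ⟨_, .synchL (hP ρ) (hQ ρ), mixedState_point ρ _⟩⟩
  | synchR h h' _ _ =>
    obtain ⟨P', hP⟩ := h.visible nofun
    obtain ⟨Q', hQ⟩ := h'.visible nofun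
    exact ⟨Finsupp.lsingle (.par P' Q'), fun ρ =>
      ⟨_, .synchR (hP ρ) (hQ ρ), mixedState_point ρ _⟩⟩
  | @restr S _ P c μ s Δ hr _ ih =>
    obtain ⟨L, h⟩ := ih
    refine ⟨Finsupp.lmapDomain (OpOn S) ℝ≥0 (fun P => .restr P c) ∘ₗ L, fun ρ => ?_⟩
    obtain ⟨Δ', h', hΔ'⟩ := h ρ
    refine ⟨_, .restr hr h', ?_⟩
    rw [LinearMap.comp_apply, ← hΔ']
    exact mixedState_map S (fun P => .restr P c) Δ'

/-! ## Determinism -/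

namespace Proc

theorem Deterministic.locallyDeterministic {P : Proc} (h : P.Deterministic) :
    P.LocallyDeterministic :=
  h P .refl

theorem Deterministic.succ {P P' : Proc} (h : P.Deterministic) (hs : P.Succ P') :
    P'.Deterministic :=
  fun _ hP => h _ (.head hs hP)

theorem Deterministic.of_step {S : Finset QName} {Γ : Set Expr} {C C' : Conf}
    (h : C.proc.Deterministic) (hC : C.Typed S Γ) {μ : Act} {s : Sched} {Δ : SDist Conf}
    (hs : Step C μ s Δ) (hC' : C' ∈ Δ.weight.support) : C'.proc.Deterministic :=
  h.succ ⟨C, S, Γ, μ, s, Δ, rfl, hC, hs, C', hC', rfl⟩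

theorem LocallyDeterministic.step {S : Finset QName} {Γ : Set Expr} {C : Conf}
    (h : C.proc.LocallyDeterministic) (hC : C.Typed S Γ) {s : Sched} {μ μ' : Act}
    {Δ Δ' : SDist Conf} (h₁ : Step C μ s Δ) (h₂ : Step C μ' s Δ') :
    (μ = μ' ∧ Δ = Δ') ∨ (μ ≠ μ' ∧ ∃ c v v', μ = .recv c v ∧ μ' = .recv c v') :=
  h C S Γ rfl hC s μ μ' Δ Δ' h₁.sched_tags_subset h₁ h₂

theorem _root_.LqCCS.Conf.Typed.of_par {S : Finset QName} {Γ : Set Expr} {T : Finset QName}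
    {ρ : Density T} {P Q : Proc} (h : (⟨T, ρ, .par P Q⟩ : Conf).Typed S Γ) :
    ∃ Γ₁ Γ₂, (⟨T, ρ, P⟩ : Conf).Typed S Γ₁ ∧ (⟨T, ρ, Q⟩ : Conf).Typed S Γ₂ := by
  obtain ⟨hS, hΓ, hcl, hT⟩ := h
  obtain ⟨hP, hQ⟩ := Set.union_empty_iff.1 hcl
  cases hT with | par hd h₁ h₂ => ?_
  exact ⟨_, _, ⟨hS, Set.subset_union_left.trans hΓ, hP, h₁⟩,
    ⟨hS, Set.subset_union_right.trans hΓ, hQ, h₂⟩⟩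

/-- By disjointness of tags, one scheduler cannot serve both a move of one side alone and a move
involving the other side. Within a synchronization the sender is unique, which fixes the channel and
the value; for that fixed input the receiver is unique too. -/
theorem LocallyDeterministic.par {P Q : Proc} (hP : P.LocallyDeterministic)
    (hQ : Q.LocallyDeterministic) (hd : Disjoint P.tags Q.tags) :
    (Proc.par P Q).LocallyDeterministic := by
  rintro ⟨T, ρ, P₀⟩ S Γ rfl hC s μ μ' Δ Δ' - h₁ h₂
  obtain ⟨Γ₁, Γ₂, hC₁, hC₂⟩ := hC.of_par
  have tP {μ s Δ} (h : Step ⟨T, ρ, P⟩ μ s Δ) : s.tags ⊆ P.tags := h.sched_tags_subset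
  have tQ {μ s Δ} (h : Step ⟨T, ρ, Q⟩ μ s Δ) : s.tags ⊆ Q.tags := h.sched_tags_subset
  have no {t} (h : t ∈ P.tags) (h' : t ∈ Q.tags) : False := Set.disjoint_left.1 hd h h'
  have noS {s : Sched} (h : s.tags ⊆ P.tags) (h' : s.tags ⊆ Q.tags) : False :=
    s.tags_nonempty.elim fun _ ht => no (h ht) (h' ht)
  cases h₁ with
  | parL _ h₁ =>
    cases h₂ with
    | parL _ h₂ =>
      exact (hP.step hC₁ h₁ h₂).imp_left fun ⟨hμ, hΔ⟩ => ⟨hμ, hΔ ▸ rfl⟩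
    | parR _ h₂ => exact (noS (tP h₁) (tQ h₂)).elim
    | synchL _ h₂ | synchR _ h₂ => exact (no (tP h₁ (.inr rfl)) (tQ h₂ rfl)).elim
  | parR _ h₁ =>
    cases h₂ with
    | parL _ h₂ => exact (noS (tP h₂) (tQ h₁)).elim
    | parR _ h₂ =>
      exact (hQ.step hC₂ h₁ h₂).imp_left fun ⟨hμ, hΔ⟩ => ⟨hμ, hΔ ▸ rfl⟩
    | synchL h₂ _ | synchR h₂ _ => exact (no (tP h₂ rfl) (tQ h₁ (.inl rfl))).elim
  | synchL h₁ h₁' =>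
    cases h₂ with
    | parL _ h₂ => exact (no (tP h₂ (.inr rfl)) (tQ h₁' rfl)).elim
    | parR _ h₂ => exact (no (tP h₁ rfl) (tQ h₂ (.inl rfl))).elim
    | synchL h₂ h₂' =>
      rcases hP.step hC₁ h₁ h₂ with ⟨hμ, hΔ⟩ | ⟨-, c, v, v', hμ, -⟩
      · cases hμ
        cases SDist.point_injective hΔ
        rcases hQ.step hC₂ h₁' h₂' with ⟨-, hΔ⟩ | ⟨hμ, -⟩
        · cases SDist.point_injective hΔ
          exact .inl ⟨rfl, rfl⟩
        · exact absurd rfl hμ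
      · cases hμ
    | synchR h₂ h₂' =>
      -- The left side would send and receive under one scheduler: the actions are neither equal nor
      -- both inputs.
      rcases hP.step hC₁ h₁ h₂ with ⟨hμ, -⟩ | ⟨-, c, v, v', hμ, -⟩ <;> cases hμ
  | synchR h₁ h₁' =>
    cases h₂ with
    | parL _ h₂ => exact (no (tP h₂ (.inr rfl)) (tQ h₁' rfl)).elim
    | parR _ h₂ => exact (no (tP h₁ rfl) (tQ h₂ (.inl rfl))).elim
    | synchL h₂ h₂' =>
      rcases hP.step hC₁ h₁ h₂ with ⟨hμ, -⟩ | ⟨-, c, v, v', -, hμ⟩ <;> cases hμ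
    | synchR h₂ h₂' =>
      rcases hQ.step hC₂ h₁' h₂' with ⟨hμ, hΔ⟩ | ⟨-, c, v, v', hμ, -⟩
      · cases hμ
        cases SDist.point_injective hΔ
        rcases hP.step hC₁ h₁ h₂ with ⟨-, hΔ⟩ | ⟨hμ, -⟩
        · cases SDist.point_injective hΔ
          exact .inl ⟨rfl, rfl⟩
        · exact absurd rfl hμ
      · cases hμ

theorem Succ.tags_subset {P P' : Proc} (h : P.Succ P') : P'.tags ⊆ P.tags := by
  obtain ⟨C, _, _, _, _, _, rfl, _, hs, C', hC', rfl⟩ := h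
  exact hs.tags_subset C' hC'

theorem Succ.of_par {P Q R : Proc} (h : (Proc.par P Q).Succ R) :
    ∃ P' Q', R = .par P' Q' ∧ Relation.ReflTransGen Succ P P' ∧
      Relation.ReflTransGen Succ Q Q' := by
  obtain ⟨⟨T, ρ, P₀⟩, S, Γ, μ, s, Δ, rfl, hC, hs, C', hC', rfl⟩ := h
  obtain ⟨Γ₁, Γ₂, hC₁, hC₂⟩ := hC.of_par
  have sP {μ s Δ D} (h : Step ⟨T, ρ, P⟩ μ s Δ) (hD : D ∈ Δ.weight.support) :
      Relation.ReflTransGen Succ P D.proc := .single ⟨_, _, _, _, _, _, rfl, hC₁, h, D, hD, rfl⟩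
  have sQ {μ s Δ D} (h : Step ⟨T, ρ, Q⟩ μ s Δ) (hD : D ∈ Δ.weight.support) :
      Relation.ReflTransGen Succ Q D.proc := .single ⟨_, _, _, _, _, _, rfl, hC₂, h, D, hD, rfl⟩
  cases hs with
  | parL _ h =>
    obtain ⟨D, hD, rfl⟩ := SDist.exists_of_mem_support_map hC'
    exact ⟨D.proc, Q, rfl, sP h hD, .refl⟩
  | parR _ h =>
    obtain ⟨D, hD, rfl⟩ := SDist.exists_of_mem_support_map hC'
    exact ⟨P, D.proc, rfl, .refl, sQ h hD⟩
  | synchL h h' | synchR h h' =>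
    rw [SDist.mem_support_point hC']
    exact ⟨_, _, rfl, sP h (SDist.self_mem_support_point _),
      sQ h' (SDist.self_mem_support_point _)⟩

theorem tags_subset_of_reflTransGen {P P' : Proc} (h : Relation.ReflTransGen Succ P P') :
    P'.tags ⊆ P.tags := by
  induction h with
  | refl => exact subset_rfl
  | tail _ hs ih => exact hs.tags_subset.trans ih

/-- Everything reachable is a parallel composition of processes reachable from the two sides, and
transitions create no tags, so disjointness persists. -/
theorem Deterministic.par {P Q : Proc} (hP : P.Deterministic) (hQ : Q.Deterministic)
    (hd : Disjoint P.tags Q.tags) : (Proc.par P Q).Deterministic := by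
  intro R hR
  obtain ⟨P', Q', rfl, hP', hQ'⟩ : ∃ P' Q', R = .par P' Q' ∧ Relation.ReflTransGen Succ P P' ∧
      Relation.ReflTransGen Succ Q Q' := by
    induction hR with
    | refl => exact ⟨P, Q, rfl, .refl, .refl⟩
    | tail _ hs ih =>
      obtain ⟨P₁, Q₁, rfl, hP₁, hQ₁⟩ := ih
      obtain ⟨P₂, Q₂, rfl, hP₂, hQ₂⟩ := hs.of_par
      exact ⟨P₂, Q₂, rfl, hP₁.trans hP₂, hQ₁.trans hQ₂⟩
  exact (hP _ hP').par (hQ _ hQ')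
    (hd.mono (tags_subset_of_reflTransGen hP') (tags_subset_of_reflTransGen hQ'))

end Proc

/-! ## Left-linear liftings -/

theorem SDist.eq_zero_of_support {A : Type} {w : A →₀ ℝ≥0} (h : ¬ ∃ a, a ∈ w.support) : w = 0 :=
  Finsupp.support_eq_empty.1 (Finset.eq_empty_of_forall_notMem fun a ha => h ⟨a, ha⟩)

section Lift

variable {A B : Type} {R : A → SDist B → Prop} {Δ : SDist A} {Θ : SDist B}

theorem mem_support_of_sum_smul {n : ℕ} {w : A →₀ ℝ≥0} {p : Fin n → ℝ≥0} {ws : Fin n → A →₀ ℝ≥0}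
    (hw : w = ∑ i, p i • ws i) {i : Fin n} (hp : p i ≠ 0) {a : A} (ha : a ∈ (ws i).support) :
    a ∈ w.support := by
  rw [Finsupp.mem_support_iff] at ha ⊢
  rw [hw, Finsupp.finsetSum_apply]
  intro h
  have := Finset.sum_eq_zero_iff.1 h i (Finset.mem_univ i)
  exact (mul_ne_zero hp ha) this

theorem exists_of_mem_support_sum_smul {n : ℕ} {w : A →₀ ℝ≥0} {p : Fin n → ℝ≥0}
    {ws : Fin n → A →₀ ℝ≥0} (hw : w = ∑ i, p i • ws i) {a : A} (ha : a ∈ w.support) :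
    ∃ i, p i ≠ 0 ∧ a ∈ (ws i).support := by
  rw [Finsupp.mem_support_iff, hw, Finsupp.finsetSum_apply] at ha
  obtain ⟨i, -, hi⟩ := Finset.exists_ne_zero_of_sum_ne_zero ha
  exact ⟨i, left_ne_zero_of_mul hi, Finsupp.mem_support_iff.2 (right_ne_zero_of_mul hi)⟩

theorem Lift.forall_support (h : Lift R Δ Θ) {p : A → Prop} {q : B → Prop}
    (hR : ∀ a Θ, p a → R a Θ → ∀ b ∈ Θ.weight.support, q b)
    (hΔ : ∀ a ∈ Δ.weight.support, p a) : ∀ b ∈ Θ.weight.support, q b := by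
  induction h with
  | base h => exact hR _ _ (hΔ _ (SDist.self_mem_support_point _)) h
  | linear r _ Δs Θs _ Δ hw Θ hw' ih =>
    intro b hb
    obtain ⟨i, hi, hb⟩ := exists_of_mem_support_sum_smul hw' hb
    exact ih i (fun a ha => hΔ a (mem_support_of_sum_smul hw hi ha)) b hb

/-- A linear quantity of the target, known for single elements, is determined by the source whatever
decomposition the lifting used. -/
theorem Lift.linearMap_eq {M : Type*} [AddCommMonoid M] [Module ℝ≥0 M] (h : Lift R Δ Θ)
    {p : A → Prop} (φ : (A →₀ ℝ≥0) →ₗ[ℝ≥0] M) (ψ : (B →₀ ℝ≥0) →ₗ[ℝ≥0] M)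
    (hR : ∀ a Θ, p a → R a Θ → ψ Θ.weight = φ (Finsupp.single a 1))
    (hΔ : ∀ a ∈ Δ.weight.support, p a) : ψ Θ.weight = φ Δ.weight := by
  induction h with
  | base h => exact hR _ _ (hΔ _ (SDist.self_mem_support_point _)) h
  | linear r _ Δs Θs _ Δ hw Θ hw' ih =>
    rw [hw, hw', map_sum, map_sum]
    refine Finset.sum_congr rfl fun i _ => ?_
    rw [map_smul, map_smul]
    -- A part of coefficient zero may lie outside the support of `Δ`, where `p` is not known; it
    -- contributes nothing.
    by_cases hi : r i = 0
    · rw [hi, zero_smul, zero_smul]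
    · rw [ih i fun a ha => hΔ a (mem_support_of_sum_smul hw hi ha)]

theorem SDist.weight_le_one (Δ : SDist A) (a : A) : Δ.weight a ≤ 1 := by
  by_cases ha : a ∈ Δ.weight.support
  · exact (Finset.single_le_sum (f := Δ.weight) (fun _ _ => zero_le) ha).trans Δ.mass_le_one
  · rw [Finsupp.notMem_support_iff.1 ha]
    exact zero_le_one

theorem SDist.sum_smul_mass_le_one {n : ℕ} {p : Fin n → ℝ≥0} (hp : ∑ i, p i ≤ 1)
    (Θs : Fin n → SDist B) : ((∑ i, p i • (Θs i).weight).sum fun _ r => r) ≤ 1 := by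
  rw [← Finsupp.sum_finsetSum_index (fun _ => rfl) (fun _ _ _ => rfl)]
  refine (Finset.sum_le_sum fun i _ => ?_).trans hp
  rw [Finsupp.sum_smul_index fun _ => rfl, ← Finsupp.mul_sum]
  exact mul_le_of_le_one_right zero_le (Θs i).mass_le_one

theorem Lift.exists_of_total (hR : ∀ a, ∃ Θ, R a Θ) (Δ : SDist A) : ∃ Θ, Lift R Δ Θ := by
  choose f hf using hR
  let e := Δ.weight.support.equivFin.symm
  have hp : ∑ i, Δ.weight (e i) ≤ 1 := by
    rw [Equiv.sum_comp e fun a => Δ.weight a, Finset.sum_coe_sort]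
    exact Δ.mass_le_one
  refine ⟨⟨∑ i, Δ.weight (e i) • (f (e i)).weight, SDist.sum_smul_mass_le_one hp fun i => f (e i)⟩,
    .linear (fun i => Δ.weight (e i)) (fun i => Δ.weight_le_one _) (fun i => .point (e i : A))
      (fun i => f (e i)) (fun i => .base (hf _)) _ ?_ _ rfl⟩
  simp only [SDist.point, Finsupp.smul_single, smul_eq_mul, mul_one]
  rw [Equiv.sum_comp e fun a => Finsupp.single (a : A) (Δ.weight a),
    Finset.sum_coe_sort Δ.weight.support fun a => Finsupp.single a (Δ.weight a)]
  exact (Finsupp.sum_single _).symm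

end Lift

/-! ## Equality of mixed states is a bisimulation -/

/-- If some state enables the move, all states do, so the empty distribution is excluded and
determinism forces the linear target. If none does, every state leads to the empty distribution and
`L = 0`. -/
theorem exists_linear_stepBot (S : Finset QName) (s : Sched) (P : Proc) :
    ∃ L : OpOn S →ₗ[ℝ≥0] (Proc →₀ OpOn S), ∀ (C : Conf) (Γ : Set Expr) (Δ : SDist Conf),
      C.proc = P → C.proc.Deterministic → C.Typed S Γ → StepBot .tau s C Δ →
        mixedState S Δ.weight = L (C.stateOn S) := by
  by_cases h : ∃ (ρ : Density S) (Δ : SDist Conf), Step ⟨S, ρ, P⟩ .tau s Δ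
  · obtain ⟨ρ, Δ, h⟩ := h
    obtain ⟨L, hL⟩ := h.exists_linear
    refine ⟨L, ?_⟩
    rintro ⟨T, σ, _⟩ Γ Θ rfl hdet hC hΘ
    obtain rfl : T = S := hC.1
    obtain ⟨Θ', h', hΘ'⟩ := hL σ
    rw [Conf.stateOn_mk]
    rcases hΘ with hΘ | ⟨-, hΘ⟩
    · rcases hdet.locallyDeterministic.step hC hΘ h' with ⟨-, rfl⟩ | ⟨hμ, -⟩
      · exact hΘ'
      · exact absurd rfl hμ
    · exact absurd ⟨_, h'⟩ hΘ
  · refine ⟨0, ?_⟩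
    rintro ⟨T, σ, _⟩ Γ Θ rfl - hC hΘ
    obtain rfl : T = S := hC.1
    rcases hΘ with hΘ | ⟨rfl, -⟩
    · exact absurd ⟨_, _, hΘ⟩ h
    · exact map_zero _

/-- All states have trace one, so each configuration contributes exactly its weight to the total
trace. -/
theorem coe_mass_eq {S : Finset QName} {Δ : SDist Conf}
    (hΔ : ∀ C ∈ Δ.weight.support, C.qubits = S) :
    (Δ.mass : ℂ) = Finsupp.lsum ℝ≥0 (fun _ : Proc => Matrix.traceLinearMap (S → Fin 2) ℝ≥0 ℂ)
      (mixedState S Δ.weight) := by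
  rw [mixedState, Finsupp.linearCombination_apply, map_finsuppSum, SDist.mass, Finsupp.sum,
    Finsupp.sum, NNReal.coe_sum, Complex.ofReal_sum]
  refine Finset.sum_congr rfl fun C hC => ?_
  rw [map_smul, Finsupp.lsum_single, Matrix.traceLinearMap_apply, Conf.trace_stateOn (hΔ C hC),
    NNReal.smul_def, Complex.real_smul, mul_one]

/-- Two distributions of a common type over deterministic processes, with the same mixed state
for every process. -/
def SameMixedState (Δ Θ : SDist Conf) : Prop :=
  ∃ S Γ, DistTyped S Γ Δ ∧ DistTyped S Γ Θ ∧
    (∀ C ∈ Δ.weight.support, C.proc.Deterministic) ∧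
    (∀ C ∈ Θ.weight.support, C.proc.Deterministic) ∧
    mixedState S Δ.weight = mixedState S Θ.weight

namespace SameMixedState

variable {Δ Θ : SDist Conf}

theorem symm (h : SameMixedState Δ Θ) : SameMixedState Θ Δ := by
  obtain ⟨S, Γ, hΔ, hΘ, dΔ, dΘ, h⟩ := h
  exact ⟨S, Γ, hΘ, hΔ, dΘ, dΔ, h.symm⟩

theorem mass_eq (h : SameMixedState Δ Θ) : Δ.mass = Θ.mass := by
  obtain ⟨S, Γ, hΔ, hΘ, -, -, h⟩ := h
  have := coe_mass_eq fun C hC => (hΔ.2 C hC).1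
  rw [h, ← coe_mass_eq fun C hC => (hΘ.2 C hC).1] at this
  exact_mod_cast this

theorem exists_dstep (h : SameMixedState Δ Θ) {s : Sched} {Δ' : SDist Conf}
    (hs : DStep .tau s Δ Δ') : ∃ Θ', DStep .tau s Θ Θ' ∧ SameMixedState Δ' Θ' := by
  obtain ⟨S, Γ, hΔ, hΘ, dΔ, dΘ, h⟩ := h
  obtain ⟨Θ', hs'⟩ := Lift.exists_of_total (R := StepBot .tau s) (fun C => by
    by_cases hC : ∃ Δ, Step C .tau s Δ
    · exact hC.imp fun _ => .inl
    · exact ⟨_, .inr ⟨rfl, hC⟩⟩) Θ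
  choose L hL using exists_linear_stepBot S s
  -- The linear map on the right does not depend on `Ξ`, so equal mixed states have equal images,
  -- whichever moves were taken.
  have good {Ξ Ξ' : SDist Conf} (h : DStep .tau s Ξ Ξ') (hΞ : DistTyped S Γ Ξ)
      (d : ∀ C ∈ Ξ.weight.support, C.proc.Deterministic) :
      DistTyped S Γ Ξ' ∧ (∀ C ∈ Ξ'.weight.support, C.proc.Deterministic) ∧
        mixedState S Ξ'.weight = (Finsupp.lsum ℝ≥0 L ∘ₗ mixedState S) Ξ.weight := by
    have hp : ∀ C ∈ Ξ.weight.support, C.Typed S Γ ∧ C.proc.Deterministic :=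
      fun C hC => ⟨hΞ.2 C hC, d C hC⟩
    have hq := Lift.forall_support h
      (q := fun C => C.Typed S Γ ∧ C.proc.Deterministic) (fun C Ψ hC hΨ C' hC' => by
        rcases hΨ with hΨ | ⟨rfl, -⟩
        · exact ⟨hC.1.step hΨ C' hC', hC.2.of_step hC.1 hΨ hC'⟩
        · exact absurd hC' (by simp [SDist.empty])) hp
    refine ⟨⟨hΞ.1, fun C hC => (hq C hC).1⟩, fun C hC => (hq C hC).2,
      Lift.linearMap_eq h _ _ (fun C Ψ hC hΨ => ?_) hp⟩
    rw [LinearMap.comp_apply, mixedState_single, Finsupp.lsum_single, one_smul]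
    exact hL _ C Γ Ψ rfl hC.2 hC.1 hΨ
  obtain ⟨tΔ, dΔ', eΔ⟩ := good hs hΔ dΔ
  obtain ⟨tΘ, dΘ', eΘ⟩ := good hs' hΘ dΘ
  refine ⟨Θ', hs', S, Γ, tΔ, tΘ, dΔ', dΘ', ?_⟩
  rw [eΔ, eΘ, LinearMap.comp_apply, LinearMap.comp_apply, h]

theorem context (h : SameMixedState Δ Θ) {Γ Γ' : Set Expr} {B : Ctx} (hB : B.Typed Γ Γ')
    (cΔ : B.Compatible Γ Γ' Δ) (cΘ : B.Compatible Γ Γ' Θ) :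
    SameMixedState (B.apply Δ) (B.apply Θ) := by
  cases B with
  | hole =>
    have hid (Ξ : SDist Conf) : Ctx.hole.apply Ξ = Ξ := SDist.ext Finsupp.mapDomain_id
    rwa [hid, hid]
  | par R =>
    obtain ⟨hΓ, hR, hRcl, hRdet⟩ := hB
    obtain ⟨⟨S₁, hS₁, tΔ⟩, disjΔ⟩ := cΔ
    obtain ⟨⟨S₂, -, tΘ⟩, disjΘ⟩ := cΘ
    have hmass := h.mass_eq
    obtain ⟨S₀, Γ₀, hΔ, hΘ, dΔ, dΘ, h⟩ := h
    -- The qubit sets of the hypotheses can differ only for empty distributions, which have every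
    -- type. If one side is empty, equality of masses makes the other empty.
    obtain ⟨tΘ', h'⟩ : DistTyped S₁ Γ Θ ∧
        mixedState S₁ Δ.weight = mixedState S₁ Θ.weight := by
      by_cases hne : ∃ C, C ∈ Δ.weight.support
      · obtain ⟨C, hC⟩ := hne
        obtain rfl : S₁ = S₀ := (tΔ.2 C hC).1.symm.trans (hΔ.2 C hC).1
        exact ⟨⟨tΔ.1, fun D hD => ⟨(hΘ.2 D hD).1, tΔ.1, (tΘ.2 D hD).2.2⟩⟩, h⟩
      · have hΔ0 : Δ.weight = 0 := SDist.eq_zero_of_support hne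
        have hΘ0 : Θ.weight = 0 := by
          rw [SDist.mass, SDist.mass, hΔ0, Finsupp.sum_zero_index] at hmass
          refine SDist.eq_zero_of_support fun ⟨C, hC⟩ => ?_
          exact Finsupp.mem_support_iff.1 hC (Finset.sum_eq_zero_iff.1 hmass.symm C hC)
        exact ⟨⟨tΔ.1, fun D hD => by simp [hΘ0] at hD⟩, by rw [hΔ0, hΘ0]⟩
    have good {Ξ : SDist Conf} (t : DistTyped S₁ Γ Ξ)
        (d : ∀ C ∈ Ξ.weight.support, C.proc.Deterministic) (disj : Disjoint (distTags Ξ) R.tags) :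
        ∀ C ∈ ((Ctx.par R).apply Ξ).weight.support, C.Typed S₁ Γ' ∧ C.proc.Deterministic := by
      intro C hC
      obtain ⟨D, hD, rfl⟩ := SDist.exists_of_mem_support_map hC
      obtain ⟨hS, -, hcl, hT⟩ := t.2 D hD
      refine ⟨⟨hS, hS₁, ?_, ?_⟩, (d D hD).par hRdet (disj.mono_left ?_)⟩
      · exact Set.union_empty_iff.2 ⟨hcl, hRcl⟩
      · have := Typing.par Set.disjoint_sdiff_right hT hR
        rwa [Set.union_sdiff_cancel hΓ] at this
      · exact Set.subset_biUnion_of_mem (u := fun C : Conf => C.proc.tags) hD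
    have gΔ := good tΔ dΔ disjΔ
    have gΘ := good tΘ' dΘ disjΘ
    refine ⟨S₁, Γ', ⟨hS₁, fun C hC => (gΔ C hC).1⟩, ⟨hS₁, fun C hC => (gΘ C hC).1⟩,
      fun C hC => (gΔ C hC).2, fun C hC => (gΘ C hC).2, ?_⟩
    have e (Ξ : SDist Conf) := mixedState_map S₁ (fun P => .par P R) Ξ
    exact (e Δ).trans ((congrArg _ h').trans (e Θ).symm)

theorem isScheduledSaturatedBisimulation :
    IsScheduledSaturatedBisimulation SameMixedState := by
  refine ⟨fun Δ Θ ⟨S, Γ, hΔ, hΘ, _⟩ => ⟨S, Γ, hΔ, hΘ⟩, fun Δ Θ h => ⟨h.mass_eq, ?_⟩⟩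
  intro Γ Γ' B hB cΔ cΘ s
  have hBΔ := h.context hB cΔ cΘ
  refine ⟨fun Δ' hs => hBΔ.exists_dstep hs, fun Θ' hs => ?_⟩
  obtain ⟨Δ', hs', h'⟩ := hBΔ.symm.exists_dstep hs
  exact ⟨Δ', hs', h'.symm⟩

end SameMixedState

/-! ### Mixtures of states over a single process -/

theorem mixedState_mix {ι : Type*} [Fintype ι] {S : Finset QName} (P : Proc) (p : ι → ℝ≥0)
    (ρ : ι → Density S) (hp : ∑ i, p i ≤ 1) :
    mixedState S (SDist.mix p (fun i => (⟨S, ρ i, P⟩ : Conf)) hp).weight =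
      Finsupp.single P (∑ i, (p i : ℂ) • (ρ i).mat) := by
  rw [SDist.mix, map_sum, Finsupp.single_finsetSum]
  refine Finset.sum_congr rfl fun i _ => ?_
  rw [mixedState_single, Conf.stateOn_mk]
  rfl

theorem typed_of_mem_support_mix {ι : Type*} [Fintype ι] {S : Finset QName} {Γ : Set Expr}
    {P : Proc} (hP : Typing Γ P) (hΓ : Γ ⊆ Expr.qubit '' (S : Set QName)) (hclosed : P.Closed)
    (p : ι → ℝ≥0) (ρ : ι → Density S) (hp : ∑ i, p i ≤ 1) :
    ∀ C ∈ (SDist.mix p (fun i => (⟨S, ρ i, P⟩ : Conf)) hp).weight.support,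
      C.Typed S Γ ∧ C.proc = P := by
  intro C hC
  obtain ⟨i, rfl⟩ := exists_of_mem_support_sum_single hC
  exact ⟨⟨rfl, hΓ, hclosed, hP⟩, rfl⟩

end LqCCS

theorem mainTheorem2 {ι κ : Type*} [Fintype ι] [Fintype κ]
    (S : Finset LqCCS.QName) (Γ : Set LqCCS.Expr) (P : LqCCS.Proc)
    (hP : LqCCS.Typing Γ P) (hΓ : Γ ⊆ LqCCS.Expr.qubit '' (S : Set LqCCS.QName))
    (hclosed : P.Closed) (hdet : P.Deterministic)
    (p : ι → ℝ≥0) (ρ : ι → LqCCS.Density S) (hp : ∑ i, p i ≤ 1)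
    (q : κ → ℝ≥0) (σ : κ → LqCCS.Density S) (hq : ∑ j, q j ≤ 1)
    (h : ∑ i, (p i : ℂ) • (ρ i).mat = ∑ j, (q j : ℂ) • (σ j).mat) :
    LqCCS.ScheduledSaturatedBisimilar
      (LqCCS.SDist.mix p (fun i => (⟨S, ρ i, P⟩ : LqCCS.Conf)) hp)
      (LqCCS.SDist.mix q (fun j => (⟨S, σ j, P⟩ : LqCCS.Conf)) hq) := by
  have tp := LqCCS.typed_of_mem_support_mix hP hΓ hclosed p ρ hp
  have tq := LqCCS.typed_of_mem_support_mix hP hΓ hclosed q σ hq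
  refine ⟨_, LqCCS.SameMixedState.isScheduledSaturatedBisimulation, S, Γ,
    ⟨hΓ, fun C hC => (tp C hC).1⟩, ⟨hΓ, fun C hC => (tq C hC).1⟩,
    fun C hC => (tp C hC).2 ▸ hdet, fun C hC => (tq C hC).2 ▸ hdet, ?_⟩
  rw [LqCCS.mixedState_mix, LqCCS.mixedState_mix, h]
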